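/- For every $\Delta\in\mathbb N$ there are constants $\alpha=\alpha(\Delta)\in(0,1)$ and $C=C(\Delta)>0$ such that the following holds. Let $G=(V,E)$ be a non-empty finite simple graph with $n=|V|$ vertices, of maximal degree at most $\Delta$, all of whose connected components have at least $3$ vertices. Let $G^*$ be the random graph obtained from $G$ by picking a uniformly random perfect matching of $V$ (if $n$ is odd, a uniformly random matching that leaves exactly one vertex unmatched) and adding an edge between each pair of matched vertices. Let $P$ be the transition matrix of simple random walk on $G^*$, let $\lambda_2(G^*)$ be the second largest eigenvalue of $P$ (counted with multiplicity), and let $\lambda_{\min}(G^*)$ be its smallest eigenvalue. Then $$\mathbb P\bigl(1-\lambda_2(G^*)\le\alpha\bigr)\le C n^{-\alpha}\qquad\text{and}\qquad \mathbb P\bigl(1+\lambda_{\min}(G^*)\le\alpha\bigr)\le C n^{-\alpha}.$$ Moreover, with probability at least $1-Cn^{-\alpha}$ the graph $G^*$ is connected and the absolute spectral gap $\gamma=1-\max\{|\lambda| : \lambda\text{ an eigenvalue of }P,\ \lambda\ne 1\}$ satisfies $\gamma>\alpha$. All of this holds both when a matched pair that is already an edge of $G$ is joined by a single edge in $G^*$,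 and when it is joined by two parallel edges. -/

import Mathlib

noncomputable section

/-- A subgraph `M` of the complete graph on `V` is a *near-perfect matching* if it is a matching
that leaves no vertex unmatched when `|V|` is even, and exactly one vertex unmatched when `|V|`
is odd. -/
def IsNearPerfectMatching {V : Type*} [Fintype V]
    (M : (⊤ : SimpleGraph V).Subgraph) : Prop :=
  M.IsMatching ∧ (M.vertsᶜ).ncard = Fintype.card V % 2

/-- The probability of the event `E` when `M` is a uniformly random near-perfect matching
of the finite set `V`. -/
def matchingProb (V : Type*) [Fintype V] (E : (⊤ : SimpleGraph V).Subgraph → Prop) : ℝ :=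
  ({M : (⊤ : SimpleGraph V).Subgraph | IsNearPerfectMatching M ∧ E M}.ncard : ℝ) /
    ({M : (⊤ : SimpleGraph V).Subgraph | IsNearPerfectMatching M}.ncard : ℝ)

/-- The two ways of reading "add the edges of the matching to `G`" at a matched pair that is
already an edge of `G`: the two edges are merged into one (`G*` is a simple graph whose edge set is
the union of the two edge sets), or they are kept as parallel edges (`G*` is a multigraph). -/
inductive EdgeConvention
  | merged
  | parallel

open Classical in
/-- The adjacency matrix of `G*`: the `(x, y)` entry is the number of edges of `G*` that join
`x` and `y`. -/
def starAdj {V : Type*} (c : EdgeConvention) (G : SimpleGraph V)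
    (M : (⊤ : SimpleGraph V).Subgraph) : Matrix V V ℝ :=
  match c with
  | .merged => (G ⊔ M.spanningCoe).adjMatrix ℝ
  | .parallel => G.adjMatrix ℝ + M.spanningCoe.adjMatrix ℝ

/-- The transition matrix of simple random walk on the (multi)graph with adjacency matrix `A`:
from `x`, the walk crosses one of the edges at `x` chosen uniformly at random. -/
def walkMatrix {V : Type*} [Fintype V] (A : Matrix V V ℝ) : Matrix V V ℝ :=
  Matrix.of fun x y => A x y / ∑ z, A x z

/-- The transition matrix of simple random walk on `G*`. -/
def starWalk {V : Type*} [Fintype V] (c : EdgeConvention) (G : SimpleGraph V)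
    (M : (⊤ : SimpleGraph V).Subgraph) : Matrix V V ℝ :=
  walkMatrix (starAdj c G M)

/-- The real eigenvalues of a square matrix, with multiplicity, in decreasing order. -/
def eigenvalueList {V : Type*} [Fintype V] [DecidableEq V] (P : Matrix V V ℝ) : List ℝ :=
  P.charpoly.roots.sort (· ≥ ·)

/-- The second largest eigenvalue (eigenvalues are counted with multiplicity). -/
def lambdaTwo {V : Type*} [Fintype V] [DecidableEq V] (P : Matrix V V ℝ) : ℝ :=
  (eigenvalueList P).getD 1 0

/-- The smallest eigenvalue. -/
def lambdaMin {V : Type*} [Fintype V] [DecidableEq V] (P : Matrix V V ℝ) : ℝ :=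
  (eigenvalueList P).getLastD 0

/-- The absolute spectral gap of an irreducible reversible transition matrix `P`:
`1 - max {|l| : l an eigenvalue of P with l ≠ 1}`. -/
def absSpectralGap {V : Type*} [Fintype V] [DecidableEq V] (P : Matrix V V ℝ) : ℝ :=
  1 - sSup {r : ℝ | ∃ l ∈ spectrum ℝ P, l ≠ 1 ∧ r = |l|}

end

open scoped Finset

section Cheeger

open scoped Classical

variable {V : Type*} [Fintype V]

theorem abs_sub_sign_mul_split {m a b : ℝ} (hm : 0 < m) (ha : a = 0 ∨ m ≤ |a|)
    (hb : b = 0 ∨ m ≤ |b|) :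
    |a - b| = m * |(SignType.sign a : ℝ) - (SignType.sign b : ℝ)| +
      |(a - m * (SignType.sign a : ℝ)) - (b - m * (SignType.sign b : ℝ))| := by
  have key : ∀ a : ℝ, (a = 0 ∨ m ≤ |a|) →
      (a = 0 ∧ (SignType.sign a : ℝ) = 0) ∨ (m ≤ a ∧ (SignType.sign a : ℝ) = 1) ∨
        (a ≤ -m ∧ (SignType.sign a : ℝ) = -1) := by
    intro a ha
    rcases ha with rfl | ha
    · left; simp
    · rcases le_abs'.mp ha with h | h
      · right; right; exact ⟨h, by rw [sign_neg (by linarith)]; simp⟩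
      · right; left; exact ⟨h, by rw [sign_pos (by linarith)]; simp⟩
  rcases key a ha with ⟨h1, h2⟩ | ⟨h1, h2⟩ | ⟨h1, h2⟩ <;>
  rcases key b hb with ⟨h3, h4⟩ | ⟨h3, h4⟩ | ⟨h3, h4⟩ <;>
  rw [h2, h4] <;> norm_num <;> subst_vars
  · rw [abs_of_nonpos, abs_of_nonpos] <;> linarith
  · rw [abs_of_nonneg, abs_of_nonneg] <;> linarith
  · rw [abs_of_nonneg, abs_of_nonneg] <;> linarith
  · rw [abs_of_nonneg (show 0 ≤ a - b by linarith),
      abs_of_nonneg (show 0 ≤ a - m - (b + m) by linarith)]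
    linarith
  · rw [abs_of_nonpos, abs_of_nonpos] <;> linarith
  · rw [abs_of_nonpos (show a - b ≤ 0 by linarith),
      abs_of_nonpos (show a + m - (b - m) ≤ 0 by linarith)]
    linarith

theorem sign_unit_mul {σ : SignType} (hσ : σ = 1 ∨ σ = -1) (a : ℝ) :
    (SignType.sign ((σ : ℝ) * a) : ℝ) = σ * SignType.sign a := by
  rcases hσ with rfl | rfl <;> simp [Left.sign_neg]

/-- A linear isoperimetric inequality for sign vectors extends to all real vectors. -/
theorem layer_cake (A : V → V → ℝ) {σ : SignType} (hσ : σ = 1 ∨ σ = -1) (h : ℝ) (k : ℕ) :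
    ∀ g : V → ℝ, #{x | g x ≠ 0} = k →
      (∀ y : V → SignType, y ≠ 0 → (∀ x, y x ≠ 0 → y x = SignType.sign (g x)) →
        h * (#{x | y x ≠ 0} : ℝ) ≤ ∑ x, ∑ z, A x z * |(y x : ℝ) - σ * y z|) →
      h * ∑ x, |g x| ≤ ∑ x, ∑ z, A x z * |g x - σ * g z| := by
  induction k using Nat.strong_induction_on with
  | _ k ih =>
  intro g hk hy
  by_cases hne : ({x | g x ≠ 0} : Finset V).Nonempty
  · obtain ⟨x₀, hx₀, hmin⟩ := Finset.exists_min_image _ (fun x => |g x|) hne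
    simp only [Finset.mem_filter, Finset.mem_univ, true_and] at hx₀ hmin
    set m := |g x₀| with hm
    have hm0 : 0 < m := abs_pos.mpr hx₀
    have hz : ∀ x, g x = 0 ∨ m ≤ |g x| := fun x => by
      by_cases hx : g x = 0
      · exact Or.inl hx
      · exact Or.inr (hmin x hx)
    let g' : V → ℝ := fun x => g x - m * (SignType.sign (g x) : ℝ)
    have hsg : ∀ x, g' x ≠ 0 → SignType.sign (g' x) = SignType.sign (g x) := by
      intro x hx
      rcases hz x with h0 | h0
      · simp [g', h0] at hx
      · rcases le_abs'.mp h0 with h1 | h1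
        · have : SignType.sign (g x) = -1 := sign_neg (by linarith)
          simp only [g', this] at hx ⊢
          simp only [SignType.coe_neg, SignType.coe_one] at hx ⊢
          apply sign_neg
          apply lt_of_le_of_ne _ hx
          linarith
        · have : SignType.sign (g x) = 1 := sign_pos (by linarith)
          simp only [g', this] at hx ⊢
          simp only [SignType.coe_one] at hx ⊢
          apply sign_pos
          apply lt_of_le_of_ne _ hx.symm
          linarith
    have hlt : #{x | g' x ≠ 0} < k := by
      rw [← hk]
      apply Finset.card_lt_card
      refine Finset.ssubset_iff_of_subset ?_ |>.mpr ⟨x₀, by simpa using hx₀, ?_⟩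
      · intro x hx
        simp only [Finset.mem_filter, Finset.mem_univ, true_and] at hx ⊢
        intro h0
        exact hx (by simp [g', h0])
      · simp only [Finset.mem_filter, Finset.mem_univ, true_and, not_not, g', hm]
        simp [abs_mul_sign]
    have h1 := ih _ hlt g' rfl (fun y hy0 hyx => hy y hy0 (fun x hx => by
      have := hyx x hx
      rw [this]
      apply hsg
      intro h0
      rw [h0, sign_zero] at this
      exact hx this))
    have h2 := hy (fun x => SignType.sign (g x))
      (fun h0 => hx₀ (sign_eq_zero_iff.mp (congrFun h0 x₀))) (fun x _ => rfl)
    have h3 : ∀ x z, |g x - σ * g z| = m * |(SignType.sign (g x) : ℝ) - σ * SignType.sign (g z)|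
        + |g' x - σ * g' z| := by
      intro x z
      have := abs_sub_sign_mul_split (a := g x) (b := σ * g z) hm0 (hz x) (by
        rcases hσ with rfl | rfl <;> simpa using hz z)
      rw [sign_unit_mul hσ] at this
      rw [this]
      simp only [g']
      congr 2
      ring
    have h4 : ∀ x, |g x| = m * (if g x ≠ 0 then 1 else 0) + |g' x| := by
      intro x
      have := abs_sub_sign_mul_split (a := g x) (b := 0) hm0 (hz x) (Or.inl rfl)
      simp only [sub_zero, sign_zero, SignType.coe_zero, mul_zero] at this
      rw [this]
      congr 2
      split_ifs with h0
      · rcases lt_or_gt_of_ne h0 with h5 | h5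
        · simp [sign_neg h5]
        · simp [sign_pos h5]
      · push Not at h0; simp [h0]
    simp only [h3, h4, mul_add, Finset.sum_add_distrib]
    simp only [sign_ne_zero] at h2
    have h5 : ∑ x, m * (if g x ≠ 0 then (1 : ℝ) else 0) = m * (#{x | g x ≠ 0} : ℝ) := by
      rw [← Finset.mul_sum, Finset.sum_boole]
    have h6 : ∑ x, ∑ z, A x z * (m * |(SignType.sign (g x) : ℝ) - σ * SignType.sign (g z)|) =
        m * ∑ x, ∑ z, A x z * |(SignType.sign (g x) : ℝ) - σ * SignType.sign (g z)| := by
      simp only [Finset.mul_sum]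
      refine Finset.sum_congr rfl fun x _ => Finset.sum_congr rfl fun z _ => by ring
    rw [h5, h6]
    have := mul_le_mul_of_nonneg_left h2 hm0.le
    linarith
  · have h0 : ∀ x, g x = 0 := by
      intro x
      by_contra hx
      exact hne ⟨x, by simpa using hx⟩
    simp [h0]

theorem abs_mul_abs_sub_le (a b : ℝ) :
    |(a * |a| - b * |b|)| ≤ |a - b| * (|a| + |b|) := by
  rcases le_total 0 a with ha | ha <;> rcases le_total 0 b with hb | hb
  · rw [abs_of_nonneg ha, abs_of_nonneg hb, ← abs_of_nonneg (add_nonneg ha hb), ← abs_mul]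
    apply le_of_eq; congr 1; ring
  · rw [abs_of_nonneg ha, abs_of_nonpos hb, abs_of_nonneg (by nlinarith),
      abs_of_nonneg (by linarith)]
    nlinarith
  · rw [abs_of_nonpos ha, abs_of_nonneg hb, abs_of_nonpos (by nlinarith),
      abs_of_nonpos (by linarith)]
    nlinarith
  · rw [abs_of_nonpos ha, abs_of_nonpos hb, ← abs_of_nonneg (show 0 ≤ -a + -b by linarith),
      ← abs_mul]
    apply le_of_eq; congr 1; ring

/-- Cheeger's inequality and its antiferromagnetic counterpart. -/
theorem cheeger_inequality {A : V → V → ℝ} (hA : ∀ x z, 0 ≤ A x z) (hs : ∀ x z, A x z = A z x)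
    {D : ℝ} (hD : ∀ x, ∑ z, A x z ≤ D) {σ : SignType} (hσ : σ = 1 ∨ σ = -1) {h : ℝ} (hh : 0 ≤ h)
    (f : V → ℝ)
    (hy : ∀ y : V → SignType, y ≠ 0 → (∀ x, y x ≠ 0 → y x = SignType.sign (f x)) →
        h * (#{x | y x ≠ 0} : ℝ) ≤ ∑ x, ∑ z, A x z * |(y x : ℝ) - σ * y z|) :
    h ^ 2 * ∑ x, f x ^ 2 ≤ 4 * D * ∑ x, ∑ z, A x z * (f x - σ * f z) ^ 2 := by
  set S := ∑ x, f x ^ 2 with hS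
  set Q := ∑ x, ∑ z, A x z * (f x - σ * f z) ^ 2 with hQ
  set T := ∑ x, ∑ z, A x z * (|f x| + |f z|) ^ 2 with hT
  have hS0 : 0 ≤ S := Finset.sum_nonneg fun _ _ => sq_nonneg _
  have hQ0 : 0 ≤ Q := Finset.sum_nonneg fun _ _ => Finset.sum_nonneg fun _ _ =>
    mul_nonneg (hA _ _) (sq_nonneg _)
  rcases isEmpty_or_nonempty V with hV | ⟨⟨v₀⟩⟩
  · simp [hS, hQ]
  have hD0 : 0 ≤ D := (Finset.sum_nonneg fun _ _ => hA _ _).trans (hD v₀)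
  have h1 := layer_cake A hσ h _ (fun x => f x * |f x|) rfl (fun y hy0 hyx => hy y hy0 (fun x hx => by
    rw [hyx x hx, sign_mul]
    rcases eq_or_ne (f x) 0 with h0 | h0
    · simp [h0]
    · rw [sign_pos (abs_pos.mpr h0), mul_one]))
  have h2 : ∀ x z, |(f x * |f x| - σ * (f z * |f z|))| ≤ |f x - σ * f z| * (|f x| + |f z|) := by
    intro x z
    have := abs_mul_abs_sub_le (f x) (σ * f z)
    rcases hσ with rfl | rfl <;> simpa using this
  have hL : h * S ≤ ∑ x, ∑ z, A x z * (|f x - σ * f z| * (|f x| + |f z|)) := by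
    refine le_trans (le_of_eq ?_) (h1.trans ?_)
    · rw [hS]; congr 1
      refine Finset.sum_congr rfl fun x _ => ?_
      rw [abs_mul, abs_abs, ← sq, sq_abs]
    · exact Finset.sum_le_sum fun x _ => Finset.sum_le_sum fun z _ =>
        mul_le_mul_of_nonneg_left (h2 x z) (hA x z)
  have hCS : (∑ x, ∑ z, A x z * (|f x - σ * f z| * (|f x| + |f z|))) ^ 2 ≤ Q * T := by
    rw [hQ, hT]
    simp only [← Finset.sum_product']
    apply Finset.sum_sq_le_sum_mul_sum_of_sq_le_mul
    · intro i _; exact mul_nonneg (hA _ _) (sq_nonneg _)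
    · intro i _; exact mul_nonneg (hA _ _) (sq_nonneg _)
    · intro i _
      rw [mul_pow, mul_pow, sq_abs]; apply le_of_eq; ring
  have hT4 : T ≤ 4 * D * S := by
    have e1 : ∑ x, ∑ z, A x z * f x ^ 2 ≤ D * S := by
      rw [hS, Finset.mul_sum]
      refine Finset.sum_le_sum fun x _ => ?_
      rw [← Finset.sum_mul]
      exact mul_le_mul_of_nonneg_right (hD x) (sq_nonneg _)
    have e2 : ∑ x, ∑ z, A x z * f z ^ 2 ≤ D * S := by
      rw [Finset.sum_comm]
      refine le_trans (le_of_eq ?_) e1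
      exact Finset.sum_congr rfl fun x _ => Finset.sum_congr rfl fun z _ => by rw [hs]
    have e3 : T ≤ ∑ x, ∑ z, (2 * (A x z * f x ^ 2) + 2 * (A x z * f z ^ 2)) := by
      refine Finset.sum_le_sum fun x _ => Finset.sum_le_sum fun z _ => ?_
      have : (|f x| + |f z|) ^ 2 ≤ 2 * f x ^ 2 + 2 * f z ^ 2 := by
        rw [← sq_abs (f x), ← sq_abs (f z)]
        nlinarith [sq_nonneg (|f x| - |f z|)]
      nlinarith [mul_le_mul_of_nonneg_left this (hA x z)]
    simp only [Finset.sum_add_distrib, ← Finset.mul_sum] at e3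
    linarith
  rcases hS0.eq_or_lt with h0 | h0
  · rw [← h0]; simp; positivity
  · have h3 : (h * S) ^ 2 ≤ Q * (4 * D * S) :=
      (pow_le_pow_left₀ (by positivity) hL 2).trans
        (hCS.trans (mul_le_mul_of_nonneg_left hT4 hQ0))
    have : (h ^ 2 * S) * S ≤ (4 * D * Q) * S := by nlinarith
    exact le_of_mul_le_mul_right this h0

end Cheeger

section Spectral

open scoped Classical in
theorem exists_median {V : Type*} [Fintype V] [Nonempty V] (f : V → ℝ) :
    ∃ m, 2 * #{x | m < f x} ≤ Fintype.card V ∧ 2 * #{x | f x < m} ≤ Fintype.card V := by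
  set S : Finset V := {x | Fintype.card V ≤ 2 * #{z | f z ≤ f x}} with hS
  have hne : S.Nonempty := by
    obtain ⟨x, -, hx⟩ := Finset.exists_max_image Finset.univ f Finset.univ_nonempty
    refine ⟨x, ?_⟩
    rw [hS, Finset.mem_filter]
    have : ({z | f z ≤ f x} : Finset V) = Finset.univ := by
      ext z; simpa using hx z (Finset.mem_univ _)
    rw [this, Finset.card_univ]
    exact ⟨Finset.mem_univ _, by omega⟩
  obtain ⟨x, hxS, hx⟩ := Finset.exists_min_image S f hne
  refine ⟨f x, ?_, ?_⟩
  · have h1 : Fintype.card V ≤ 2 * #{z | f z ≤ f x} := (Finset.mem_filter.mp hxS).2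
    have h2 := Finset.card_filter_add_card_filter_not (s := (Finset.univ : Finset V)) (fun z => f z ≤ f x)
    simp only [not_le, Finset.card_univ] at h2
    omega
  · by_contra! hlt
    have hne' : ({z | f z < f x} : Finset V).Nonempty := by
      rw [← Finset.card_pos]; omega
    obtain ⟨w, hw, hwmax⟩ := Finset.exists_max_image _ f hne'
    simp only [Finset.mem_filter, Finset.mem_univ, true_and] at hw hwmax
    have hwS : w ∈ S := by
      rw [hS, Finset.mem_filter]
      refine ⟨Finset.mem_univ _, hlt.le.trans ?_⟩
      gcongr 2 * #?_
      intro z hz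
      simp only [Finset.mem_filter, Finset.mem_univ, true_and] at hz ⊢
      exact hwmax z hz
    exact absurd (hx w hwS) (not_le.mpr hw)

open Matrix

variable {V : Type*} [Fintype V]

theorem energy_eq {A : V → V → ℝ} (hs : ∀ x z, A x z = A z x) {σ : SignType}
    (hσ : σ = 1 ∨ σ = -1) (f : V → ℝ) :
    ∑ x, ∑ z, A x z * (f x - σ * f z) ^ 2 =
      2 * (∑ x, (∑ z, A x z) * f x ^ 2 - σ * ∑ x, ∑ z, A x z * (f x * f z)) := by
  have hσ2 : (σ : ℝ) ^ 2 = 1 := by rcases hσ with rfl | rfl <;> simp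
  have e1 : ∑ x, ∑ z, A x z * f x ^ 2 = ∑ x, (∑ z, A x z) * f x ^ 2 := by
    simp only [Finset.sum_mul]
  have e2 : ∑ x, ∑ z, A x z * f z ^ 2 = ∑ x, (∑ z, A x z) * f x ^ 2 := by
    rw [← e1, Finset.sum_comm]
    exact Finset.sum_congr rfl fun x _ => Finset.sum_congr rfl fun z _ => by rw [hs]
  have e3 : ∀ x z, A x z * (f x - σ * f z) ^ 2 =
      A x z * f x ^ 2 + A x z * f z ^ 2 - 2 * σ * (A x z * (f x * f z)) := by
    intro x z
    linear_combination A x z * f z ^ 2 * hσ2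
  simp only [e3, Finset.sum_sub_distrib, Finset.sum_add_distrib, ← Finset.mul_sum, e1, e2]
  ring

/-- A signed isoperimetric inequality with constant `h` for the weights `A`. -/
def SignedExpander (A : V → V → ℝ) (h : ℝ) : Prop := by
  classical exact
  ∀ σ : SignType, (σ = 1 ∨ σ = -1) → ∀ y : V → SignType, y ≠ 0 →
    (σ = 1 → 2 * #{x | y x = 1} ≤ Fintype.card V ∧ 2 * #{x | y x = -1} ≤ Fintype.card V) →
    h * (#{x | y x ≠ 0} : ℝ) ≤ ∑ x, ∑ z, A x z * |(y x : ℝ) - σ * y z|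

theorem SignedExpander.upper [Nonempty V] {A : V → V → ℝ} {h D : ℝ} (hE : SignedExpander A h)
    (hA : ∀ x z, 0 ≤ A x z)
    (hs : ∀ x z, A x z = A z x) (hD : ∀ x, ∑ z, A x z ≤ D) (hD0 : 0 < D) (hh : 0 ≤ h) (f : V → ℝ)
    (hf : ∑ x, (∑ z, A x z) * f x = 0) :
    ∑ x, ∑ z, A x z * (f x * f z) ≤ (1 - h ^ 2 / (8 * D ^ 2)) * ∑ x, (∑ z, A x z) * f x ^ 2 := by
  classical
  obtain ⟨m, hm1, hm2⟩ := exists_median f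
  have h1 := cheeger_inequality hA hs hD (σ := 1) (Or.inl rfl) hh (fun x => f x - m) (by
    intro y hy0 hy
    refine hE 1 (Or.inl rfl) y hy0 (fun _ => ⟨?_, ?_⟩)
    · refine le_trans ?_ hm1
      gcongr 2 * #?_
      intro x hx
      simp only [Finset.mem_filter, Finset.mem_univ, true_and] at hx ⊢
      have := hy x (by simp [hx])
      rw [hx, eq_comm, sign_eq_one_iff] at this
      linarith
    · refine le_trans ?_ hm2
      gcongr 2 * #?_
      intro x hx
      simp only [Finset.mem_filter, Finset.mem_univ, true_and] at hx ⊢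
      have := hy x (by simp [hx])
      rw [hx, eq_comm, sign_eq_neg_one_iff] at this
      linarith)
  have h2 : ∑ x, ∑ z, A x z * (f x - m - ((1 : SignType) : ℝ) * (f z - m)) ^ 2 =
      ∑ x, ∑ z, A x z * (f x - ((1 : SignType) : ℝ) * f z) ^ 2 := by
    refine Finset.sum_congr rfl fun x _ => Finset.sum_congr rfl fun z _ => ?_
    simp
  rw [h2, energy_eq hs (Or.inl rfl)] at h1
  simp only [SignType.coe_one, one_mul] at h1
  have h3 : ∑ x, (∑ z, A x z) * f x ^ 2 ≤ D * ∑ x, (f x - m) ^ 2 := by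
    have e : ∑ x, (∑ z, A x z) * (f x - m) ^ 2 = ∑ x, (∑ z, A x z) * f x ^ 2 +
        m ^ 2 * ∑ x, (∑ z, A x z) - 2 * m * ∑ x, (∑ z, A x z) * f x := by
      simp only [Finset.mul_sum (s := (Finset.univ : Finset V)) (f := fun x => (∑ z, A x z) * f x),
        Finset.mul_sum (s := (Finset.univ : Finset V)) (f := fun x => (∑ z, A x z)),
        ← Finset.sum_add_distrib, ← Finset.sum_sub_distrib]
      exact Finset.sum_congr rfl fun x _ => by ring
    have e2 : ∑ x, (∑ z, A x z) * (f x - m) ^ 2 ≤ D * ∑ x, (f x - m) ^ 2 := by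
      rw [Finset.mul_sum]
      exact Finset.sum_le_sum fun x _ => mul_le_mul_of_nonneg_right (hD x) (sq_nonneg _)
    have e3 : 0 ≤ m ^ 2 * ∑ x, (∑ z, A x z) := mul_nonneg (sq_nonneg _)
      (Finset.sum_nonneg fun _ _ => Finset.sum_nonneg fun _ _ => hA _ _)
    rw [hf] at e
    linarith
  have h4 : h ^ 2 * ∑ x, (∑ z, A x z) * f x ^ 2 ≤ D * (4 * D *
      (2 * (∑ x, (∑ z, A x z) * f x ^ 2 - ∑ x, ∑ z, A x z * (f x * f z)))) := by
    have := mul_le_mul_of_nonneg_left h3 (sq_nonneg h)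
    have := mul_le_mul_of_nonneg_left h1 hD0.le
    linarith
  rw [← sub_nonneg] at h4 ⊢
  have h5 := div_nonneg h4 (show 0 ≤ 8 * D ^ 2 by positivity)
  refine h5.trans (le_of_eq ?_)
  field_simp
  ring

theorem SignedExpander.lower [Nonempty V] {A : V → V → ℝ} {h D : ℝ} (hE : SignedExpander A h)
    (hA : ∀ x z, 0 ≤ A x z)
    (hs : ∀ x z, A x z = A z x) (hD : ∀ x, ∑ z, A x z ≤ D) (hD0 : 0 < D) (hh : 0 ≤ h) (f : V → ℝ) :
    -((1 - h ^ 2 / (8 * D ^ 2)) * ∑ x, (∑ z, A x z) * f x ^ 2) ≤ ∑ x, ∑ z, A x z * (f x * f z) := by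
  classical
  have h1 := cheeger_inequality hA hs hD (σ := -1) (Or.inr rfl) hh f (fun y hy0 _ =>
    hE (-1) (Or.inr rfl) y hy0 (fun h => absurd h (by decide)))
  rw [energy_eq hs (Or.inr rfl)] at h1
  simp only [SignType.coe_neg, SignType.coe_one, neg_mul, one_mul, sub_neg_eq_add] at h1
  have h3 : ∑ x, (∑ z, A x z) * f x ^ 2 ≤ D * ∑ x, f x ^ 2 := by
    rw [Finset.mul_sum]
    exact Finset.sum_le_sum fun x _ => mul_le_mul_of_nonneg_right (hD x) (sq_nonneg _)
  have h4 : h ^ 2 * ∑ x, (∑ z, A x z) * f x ^ 2 ≤ D * (4 * D *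
      (2 * (∑ x, (∑ z, A x z) * f x ^ 2 + ∑ x, ∑ z, A x z * (f x * f z)))) := by
    have := mul_le_mul_of_nonneg_left h3 (sq_nonneg h)
    have := mul_le_mul_of_nonneg_left h1 hD0.le
    linarith
  rw [← sub_nonneg] at h4 ⊢
  have h5 := div_nonneg h4 (show 0 ≤ 8 * D ^ 2 by positivity)
  refine h5.trans (le_of_eq ?_)
  field_simp
  ring

/-- The symmetric matrix conjugate to the transition matrix of simple random walk. -/
noncomputable def normalizedAdj (A : Matrix V V ℝ) : Matrix V V ℝ :=
  Matrix.of fun x z => A x z / (√(∑ w, A x w) * √(∑ w, A z w))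

theorem normalizedAdj_isHermitian {A : Matrix V V ℝ} (hs : ∀ x z, A x z = A z x) :
    (normalizedAdj A).IsHermitian := by
  ext x z
  simp [normalizedAdj, hs z x, mul_comm]

theorem walkMatrix_charpoly [DecidableEq V] {A : Matrix V V ℝ} (hd : ∀ x, 0 < ∑ z, A x z) :
    (walkMatrix A).charpoly = (normalizedAdj A).charpoly := by
  set s : V → ℝ := fun x => √(∑ w, A x w) with hsdef
  have hs0 : ∀ x, s x ≠ 0 := fun x => (Real.sqrt_pos.mpr (hd x)).ne'
  have h1 : walkMatrix A = diagonal (fun x => (s x)⁻¹) * (normalizedAdj A * diagonal s) := by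
    ext x z
    rw [Matrix.diagonal_mul, Matrix.mul_diagonal]
    have h2 : walkMatrix A x z = A x z / (s x * s x) := by
      rw [hsdef, Real.mul_self_sqrt (hd x).le]; rfl
    rw [h2]
    have h3 := hs0 x
    have h4 := hs0 z
    change A x z / (s x * s x) = (s x)⁻¹ * (A x z / (s x * s z) * s z)
    field_simp
  rw [h1, Matrix.charpoly_mul_comm, Matrix.mul_assoc, Matrix.diagonal_mul_diagonal]
  have : (fun i => s i * (s i)⁻¹) = fun _ => 1 := by
    ext i; exact mul_inv_cancel₀ (hs0 i)
  rw [this, Matrix.diagonal_one, Matrix.mul_one]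

section Hermitian

variable [DecidableEq V] {N : Matrix V V ℝ} (hN : N.IsHermitian)

theorem eigenvectorBasis_dotProduct (i j : V) :
    (hN.eigenvectorBasis i : V → ℝ) ⬝ᵥ (hN.eigenvectorBasis j : V → ℝ) = if i = j then 1 else 0 := by
  have := (orthonormal_iff_ite.mp hN.eigenvectorBasis.orthonormal) j i
  rw [EuclideanSpace.inner_eq_star_dotProduct] at this
  simp only [star_trivial] at this
  rw [this]
  simp [eq_comm]

theorem neg_le_eigenvalues {r : ℝ} (h : ∀ g, -(r * (g ⬝ᵥ g)) ≤ g ⬝ᵥ N *ᵥ g) (i : V) :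
    -r ≤ hN.eigenvalues i := by
  have := h (hN.eigenvectorBasis i)
  rw [hN.mulVec_eigenvectorBasis, dotProduct_smul, eigenvectorBasis_dotProduct] at this
  simpa using this

theorem eigenvalues_le {v : V → ℝ} {r : ℝ}
    (h : ∀ g, v ⬝ᵥ g = 0 → g ⬝ᵥ N *ᵥ g ≤ r * (g ⬝ᵥ g)) (hv : N *ᵥ v = v) (i : V) (hi : hN.eigenvalues i ≠ 1) :
    hN.eigenvalues i ≤ r := by
  have h0 : v ⬝ᵥ (hN.eigenvectorBasis i : V → ℝ) = 0 := by
    have h1 : v ⬝ᵥ N *ᵥ (hN.eigenvectorBasis i : V → ℝ) = v ⬝ᵥ (hN.eigenvectorBasis i : V → ℝ) := by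
      have hT : Nᵀ = N := by
        rw [← conjTranspose_eq_transpose_of_trivial]; exact hN.eq
      rw [dotProduct_mulVec, ← mulVec_transpose, hT, hv]
    rw [hN.mulVec_eigenvectorBasis, dotProduct_smul, smul_eq_mul] at h1
    have : (hN.eigenvalues i - 1) * (v ⬝ᵥ (hN.eigenvectorBasis i : V → ℝ)) = 0 := by linarith
    exact (mul_eq_zero.mp this).resolve_left (sub_ne_zero.mpr hi)
  have := h _ h0
  rw [hN.mulVec_eigenvectorBasis, dotProduct_smul, eigenvectorBasis_dotProduct] at this
  simpa using this

theorem min_eigenvalues_le {v : V → ℝ} {r : ℝ}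
    (h : ∀ g, v ⬝ᵥ g = 0 → g ⬝ᵥ N *ᵥ g ≤ r * (g ⬝ᵥ g)) {i j : V} (hij : i ≠ j) :
    min (hN.eigenvalues i) (hN.eigenvalues j) ≤ r := by
  by_contra! hlt
  obtain ⟨hi, hj⟩ := lt_min_iff.mp hlt
  set u : V → ℝ := (hN.eigenvectorBasis i).ofLp with hu
  set w : V → ℝ := (hN.eigenvectorBasis j).ofLp with hw
  have huu : u ⬝ᵥ u = 1 := by rw [hu, eigenvectorBasis_dotProduct, if_pos rfl]
  have hww : w ⬝ᵥ w = 1 := by rw [hw, eigenvectorBasis_dotProduct, if_pos rfl]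
  have huw : u ⬝ᵥ w = 0 := by rw [hu, hw, eigenvectorBasis_dotProduct, if_neg hij]
  have hwu : w ⬝ᵥ u = 0 := by rw [dotProduct_comm, huw]
  have hNu : N *ᵥ u = hN.eigenvalues i • u := hN.mulVec_eigenvectorBasis i
  have hNw : N *ᵥ w = hN.eigenvalues j • w := hN.mulVec_eigenvectorBasis j
  have key : ∀ a b : ℝ, a * (v ⬝ᵥ u) + b * (v ⬝ᵥ w) = 0 → a ^ 2 + b ^ 2 ≤ 0 := by
    intro a b hab
    have := h (a • u + b • w) (by simpa [dotProduct_add, dotProduct_smul] using hab)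
    simp only [mulVec_add, mulVec_smul, hNu, hNw, dotProduct_add, add_dotProduct, dotProduct_smul,
      smul_dotProduct, huu, hww, huw, hwu, smul_eq_mul] at this
    nlinarith [sq_nonneg a, sq_nonneg b, mul_nonneg (sub_nonneg.mpr hi.le) (sq_nonneg a),
      mul_nonneg (sub_nonneg.mpr hj.le) (sq_nonneg b),
      mul_le_mul_of_nonneg_right (min_le_left (hN.eigenvalues i - r) (hN.eigenvalues j - r)) (sq_nonneg a),
      mul_le_mul_of_nonneg_right (min_le_right (hN.eigenvalues i - r) (hN.eigenvalues j - r)) (sq_nonneg b),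
      lt_min (sub_pos.mpr hi) (sub_pos.mpr hj)]
  by_cases h0 : v ⬝ᵥ u = 0
  · have := key 1 0 (by rw [h0]; ring)
    norm_num at this
  · have := key (v ⬝ᵥ w) (-(v ⬝ᵥ u)) (by ring)
    have : 0 < (v ⬝ᵥ u) ^ 2 := by positivity
    nlinarith [sq_nonneg (v ⬝ᵥ w)]

end Hermitian

section Gap

variable [DecidableEq V] {A : Matrix V V ℝ}

theorem walkMatrix_spectral_bounds [Nonempty V] {h D : ℝ} (hE : SignedExpander A h)
    (hA : ∀ x z, 0 ≤ A x z) (hs : ∀ x z, A x z = A z x) (hd : ∀ x, 0 < ∑ z, A x z)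
    (hD : ∀ x, ∑ z, A x z ≤ D) (hD0 : 0 < D) (hh : 0 ≤ h) (hV : 2 ≤ Fintype.card V) :
    lambdaTwo (walkMatrix A) ≤ 1 - h ^ 2 / (8 * D ^ 2) ∧
    -(1 - h ^ 2 / (8 * D ^ 2)) ≤ lambdaMin (walkMatrix A) ∧
    ∀ l ∈ spectrum ℝ (walkMatrix A), l ≠ 1 → |l| ≤ 1 - h ^ 2 / (8 * D ^ 2) := by
  set r := 1 - h ^ 2 / (8 * D ^ 2) with hr
  set s : V → ℝ := fun x => √(∑ w, A x w) with hsdef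
  have hs0 : ∀ x, s x ≠ 0 := fun x => (Real.sqrt_pos.mpr (hd x)).ne'
  have hss : ∀ x, ∑ w, A x w = s x ^ 2 := fun x => (Real.sq_sqrt (hd x).le).symm
  set N := normalizedAdj A with hNdef
  have hNa : ∀ x z, N x z = A x z / (s x * s z) := fun x z => rfl
  have hN : N.IsHermitian := normalizedAdj_isHermitian hs
  have hgNg : ∀ g : V → ℝ, g ⬝ᵥ N *ᵥ g = ∑ x, ∑ z, A x z * ((g x / s x) * (g z / s z)) := by
    intro g
    simp only [dotProduct, mulVec, Finset.mul_sum, hNa]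
    refine Finset.sum_congr rfl fun x _ => Finset.sum_congr rfl fun z _ => ?_
    have := hs0 x
    have := hs0 z
    field_simp
  have hgg : ∀ g : V → ℝ, g ⬝ᵥ g = ∑ x, (∑ z, A x z) * (g x / s x) ^ 2 := by
    intro g
    simp only [dotProduct, hss]
    refine Finset.sum_congr rfl fun x _ => ?_
    have := hs0 x
    field_simp
  have hsg : ∀ g : V → ℝ, s ⬝ᵥ g = ∑ x, (∑ z, A x z) * (g x / s x) := by
    intro g
    simp only [dotProduct, hss]
    refine Finset.sum_congr rfl fun x _ => ?_
    have := hs0 x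
    field_simp
  have hNs : N *ᵥ s = s := by
    ext x
    have := hs0 x
    simp only [mulVec, dotProduct, hNa]
    have e : ∀ z, A x z / (s x * s z) * s z = A x z / s x := by
      intro z
      have := hs0 z
      field_simp
    simp only [e, ← Finset.sum_div, hss]
    field_simp
  have hup : ∀ g, s ⬝ᵥ g = 0 → g ⬝ᵥ N *ᵥ g ≤ r * (g ⬝ᵥ g) := by
    intro g hg
    rw [hgNg, hgg]
    exact hE.upper hA hs hD hD0 hh _ (by rw [← hsg, hg])
  have hlow : ∀ g, -(r * (g ⬝ᵥ g)) ≤ g ⬝ᵥ N *ᵥ g := by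
    intro g
    rw [hgNg, hgg]
    exact hE.lower hA hs hD hD0 hh _
  have hlist : eigenvalueList (walkMatrix A) = List.ofFn hN.eigenvalues₀ := by
    rw [eigenvalueList, walkMatrix_charpoly hd]
    simpa using hN.sort_roots_charpoly_eq_eigenvalues₀
  have hev₀ : ∀ k, hN.eigenvalues₀ k = hN.eigenvalues (Fintype.equivOfCardEq (Fintype.card_fin _) k) := by
    intro k
    simp [Matrix.IsHermitian.eigenvalues]
  refine ⟨?_, ?_, ?_⟩
  · rw [lambdaTwo, hlist]
    have e1 : (List.ofFn hN.eigenvalues₀).getD 1 0 = hN.eigenvalues₀ ⟨1, by omega⟩ := by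
      rw [List.getD_eq_getElem _ _ (by rw [List.length_ofFn]; omega)]
      simp
    rw [e1]
    have h2 : hN.eigenvalues₀ ⟨1, by omega⟩ ≤ hN.eigenvalues₀ ⟨0, by omega⟩ :=
      hN.eigenvalues₀_antitone (by simp)
    have h3 := min_eigenvalues_le hN hup
      (i := Fintype.equivOfCardEq (Fintype.card_fin _) ⟨0, by omega⟩)
      (j := Fintype.equivOfCardEq (Fintype.card_fin _) ⟨1, by omega⟩)
      (by rw [Ne, EmbeddingLike.apply_eq_iff_eq]; simp)
    rwa [← hev₀, ← hev₀, min_eq_right h2] at h3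
  · rw [lambdaMin, hlist]
    have hne : List.ofFn hN.eigenvalues₀ ≠ [] := by
      rw [Ne, List.ofFn_eq_nil_iff]; omega
    rw [List.getLastD_eq_getLast?, List.getLast?_eq_some_getLast hne, Option.getD_some]
    have := List.getLast_mem hne
    rw [List.mem_ofFn] at this
    obtain ⟨k, hk⟩ := this
    rw [← hk, hev₀]
    exact neg_le_eigenvalues hN hlow _
  · intro l hl hl1
    rw [Matrix.mem_spectrum_iff_isRoot_charpoly, walkMatrix_charpoly hd,
      ← Matrix.mem_spectrum_iff_isRoot_charpoly, hN.spectrum_real_eq_range_eigenvalues] at hl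
    obtain ⟨i, rfl⟩ := hl
    rw [abs_le]
    exact ⟨neg_le_eigenvalues hN hlow i, eigenvalues_le hN hup hNs i hl1⟩

theorem lt_absSpectralGap [Nonempty V] {P : Matrix V V ℝ} {r a : ℝ}
    (h : ∀ l ∈ spectrum ℝ P, l ≠ 1 → |l| ≤ r) (hr : a < 1 - r) (ha : a < 1) :
    a < absSpectralGap P := by
  rw [absSpectralGap]
  rcases Set.eq_empty_or_nonempty {r : ℝ | ∃ l ∈ spectrum ℝ P, l ≠ 1 ∧ r = |l|} with h0 | h0
  · rw [h0, Real.sSup_empty]; linarith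
  · have : sSup {r : ℝ | ∃ l ∈ spectrum ℝ P, l ≠ 1 ∧ r = |l|} ≤ r := by
      refine csSup_le h0 ?_
      rintro _ ⟨l, hl, hl1, rfl⟩
      exact h l hl hl1
    linarith

end Gap

end Spectral

section Counting

open scoped Classical

variable {V : Type*} [Fintype V]

/-- The labelled vertices with a neighbour that violates the relation `y z = σ * y x`. -/
noncomputable def defect (H : SimpleGraph V) (σ : SignType) (y : V → SignType) : Finset V :=
  {x | y x ≠ 0 ∧ ∃ z, H.Adj x z ∧ y z ≠ σ * y x}

/-- The number of vertices that carry a given label. -/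
noncomputable def labelCount (y : V → SignType) (s : SignType) : ℕ := #{x | y x = s}

/-- The probability of a sequence of type `m` under the product of its empirical measure. -/
noncomputable def typeWeight (n : ℕ) (m : SignType → ℕ) : ℝ := ∏ s, ((m s : ℝ) / n) ^ (m s)

theorem sum_signType {M : Type*} [AddCommMonoid M] (f : SignType → M) :
    ∑ s, f s = f 0 + f (-1) + f 1 := by
  rw [show (Finset.univ : Finset SignType) = {0, -1, 1} from rfl, Finset.sum_insert (by decide),
    Finset.sum_insert (by decide), Finset.sum_singleton, add_assoc]

theorem prod_signType {M : Type*} [CommMonoid M] (f : SignType → M) :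
    ∏ s, f s = f 0 * f (-1) * f 1 := by
  rw [show (Finset.univ : Finset SignType) = {0, -1, 1} from rfl, Finset.prod_insert (by decide),
    Finset.prod_insert (by decide), Finset.prod_singleton, mul_assoc]

theorem sum_labelCount (y : V → SignType) : ∑ s, labelCount y s = Fintype.card V := by
  rw [← Finset.card_univ]
  exact (Finset.card_eq_sum_card_fiberwise (fun _ _ => Finset.mem_univ _)).symm

theorem prod_label (y : V → SignType) (ω : SignType → ℝ) :
    ∏ v, ω (y v) = ∏ s, ω s ^ labelCount y s := by
  rw [← Finset.prod_fiberwise _ y]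
  refine Finset.prod_congr rfl fun s _ => ?_
  rw [labelCount, ← Finset.prod_const]
  refine Finset.prod_congr rfl fun v hv => ?_
  rw [(Finset.mem_filter.mp hv).2]

theorem exists_sign_of_reachable {V : Type*} {K : SimpleGraph V} (σ : SignType) (hσ : σ = 1 ∨ σ = -1) {u v : V}
    (h : K.Reachable u v) :
    ∃ e : SignType, (e = 1 ∨ e = -1) ∧
      ∀ y : V → SignType, (∀ x z, K.Adj x z → y z = σ * y x) → y v = e * y u := by
  obtain ⟨p⟩ := h
  induction p with
  | nil => exact ⟨1, Or.inl rfl, fun y _ => (one_mul _).symm⟩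
  | cons hadj _ ih =>
    obtain ⟨e, he, hey⟩ := ih
    refine ⟨e * σ, ?_, fun y hy => ?_⟩
    · rcases he with rfl | rfl <;> rcases hσ with rfl | rfl <;> decide
    · rw [hey y hy, hy _ _ hadj, mul_assoc]

theorem exists_exponents {V : Type*} (ω : SignType → ℝ) (e : V → SignType) (he : ∀ v, e v = 1 ∨ e v = -1)
    (F : Finset V) :
    ∃ a b, a + b = #F ∧ ∏ v ∈ F, ω (e v * 1) = ω 1 ^ a * ω (-1) ^ b ∧
      ∏ v ∈ F, ω (e v * -1) = ω (-1) ^ a * ω 1 ^ b := by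
  induction F using Finset.induction_on with
  | empty => exact ⟨0, 0, by simp⟩
  | insert v F hv ih =>
    obtain ⟨a, b, h1, h2, h3⟩ := ih
    rcases he v with h | h
    · refine ⟨a + 1, b, ?_, ?_, ?_⟩
      · rw [Finset.card_insert_of_notMem hv]; omega
      · rw [Finset.prod_insert hv, h2, h, one_mul]; ring
      · rw [Finset.prod_insert hv, h3, h, one_mul]; ring
    · refine ⟨a, b + 1, ?_, ?_, ?_⟩
      · rw [Finset.card_insert_of_notMem hv]; omega
      · rw [Finset.prod_insert hv, h2, h, mul_one]; ring
      · rw [Finset.prod_insert hv, h3, h, show (-1 : SignType) * -1 = 1 from rfl]; ring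

theorem pow_mul_pow_add_le {x y : ℝ} (hx : 0 ≤ x) (hy : 0 ≤ y) (a b : ℕ) :
    x ^ a * y ^ b + y ^ a * x ^ b ≤ x ^ (a + b) + y ^ (a + b) := by
  have h : 0 ≤ (x ^ a - y ^ a) * (x ^ b - y ^ b) := by
    rcases le_total x y with h | h
    · exact mul_nonneg_of_nonpos_of_nonpos (sub_nonpos.mpr (pow_le_pow_left₀ hx h a))
        (sub_nonpos.mpr (pow_le_pow_left₀ hx h b))
    · exact mul_nonneg (sub_nonneg.mpr (pow_le_pow_left₀ hy h a))
        (sub_nonneg.mpr (pow_le_pow_left₀ hy h b))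
  rw [pow_add, pow_add]
  linarith

/-- The generating function of one component is at most `1` if the component is large. -/
theorem component_sum_le {V : Type*} {q : ℕ} (hq : 0 < q) {p : SignType → ℝ} (hp : ∀ s, 0 ≤ p s)
    (hsum : ∑ s, p s = 1) (e : V → SignType) (he : ∀ v, e v = 1 ∨ e v = -1) (F : Finset V) :
    ∑ s, ∏ v ∈ F, p (e v * s) ^ (1 / q : ℝ) ≤ if #F < q then 3 else 1 := by
  set ω : SignType → ℝ := fun s => p s ^ (1 / q : ℝ) with hω
  have hω0 : ∀ s, 0 ≤ ω s := fun s => Real.rpow_nonneg (hp s) _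
  have hp1 : ∀ s, p s ≤ 1 := fun s => by
    rw [← hsum]; exact Finset.single_le_sum (fun i _ => hp i) (Finset.mem_univ s)
  have hω1 : ∀ s, ω s ≤ 1 := fun s => Real.rpow_le_one (hp s) (hp1 s) (by positivity)
  have hωq : ∀ s, ω s ^ q = p s := fun s => by
    rw [hω]; simp only [one_div]; exact Real.rpow_inv_natCast_pow (hp s) hq.ne'
  have h1 : ∑ s, ∏ v ∈ F, ω (e v * s) ≤ ∑ s, ω s ^ #F := by
    obtain ⟨a, b, h1, h2, h3⟩ := exists_exponents ω e he F
    rw [sum_signType, sum_signType, h2, h3]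
    have h4 : ∏ v ∈ F, ω (e v * 0) = ω 0 ^ #F := by simp
    have := pow_mul_pow_add_le (hω0 1) (hω0 (-1)) a b
    rw [h4, ← h1]
    linarith
  refine h1.trans ?_
  split_ifs with hF
  · calc ∑ s, ω s ^ #F ≤ ∑ s : SignType, (1 : ℝ) :=
          Finset.sum_le_sum fun s _ => pow_le_one₀ (hω0 s) (hω1 s)
      _ = 3 := by rw [sum_signType]; norm_num
  · rw [← hsum]
    refine Finset.sum_le_sum fun s _ => ?_
    rw [← hωq s]
    exact pow_le_pow_of_le_one (hω0 s) (hω1 s) (not_lt.mp hF)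

theorem sum_consistent_le (K : SimpleGraph V) {σ : SignType} (hσ : σ = 1 ∨ σ = -1) {q : ℕ}
    (hq : 0 < q) {p : SignType → ℝ} (hp : ∀ s, 0 ≤ p s) (hsum : ∑ s, p s = 1) :
    ∑ y : V → SignType with ∀ x z, K.Adj x z → y z = σ * y x, ∏ v, p (y v) ^ (1 / q : ℝ) ≤
      3 ^ #{c : K.ConnectedComponent | #{v | K.connectedComponentMk v = c} < q} := by
  set ω : SignType → ℝ := fun s => p s ^ (1 / q : ℝ) with hω
  have hω0 : ∀ s, 0 ≤ ω s := fun s => Real.rpow_nonneg (hp s) _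
  have hreach : ∀ v, K.Reachable (K.connectedComponentMk v).out v := fun v =>
    SimpleGraph.ConnectedComponent.exact (Quot.out_eq (K.connectedComponentMk v))
  choose e he hey using fun v => exists_sign_of_reachable σ hσ (hreach v)
  let φ : (V → SignType) → (K.ConnectedComponent → SignType) := fun y c => y c.out
  let F : (K.ConnectedComponent → SignType) → ℝ := fun g =>
    ∏ v, ω (e v * g (K.connectedComponentMk v))
  set S : Finset (V → SignType) := {y | ∀ x z, K.Adj x z → y z = σ * y x} with hS
  have hSm : ∀ y ∈ S, ∀ v, y v = e v * φ y (K.connectedComponentMk v) := fun y hy v =>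
    hey v y (Finset.mem_filter.mp hy).2
  have hinj : Set.InjOn φ S := by
    intro y hy y' hy' h
    ext1 v
    rw [hSm y hy, hSm y' hy', h]
  calc ∑ y ∈ S, ∏ v, ω (y v) = ∑ y ∈ S, F (φ y) := by
        refine Finset.sum_congr rfl fun y hy => Finset.prod_congr rfl fun v _ => ?_
        rw [hSm y hy v]
    _ = ∑ g ∈ S.image φ, F g := (Finset.sum_image hinj).symm
    _ ≤ ∑ g, F g := Finset.sum_le_sum_of_subset_of_nonneg (Finset.subset_univ _)
        fun g _ _ => Finset.prod_nonneg fun v _ => hω0 _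
    _ = ∑ g : K.ConnectedComponent → SignType,
          ∏ c, ∏ v with K.connectedComponentMk v = c, ω (e v * g c) := by
        refine Finset.sum_congr rfl fun g _ => ?_
        simp only [F]
        rw [← Finset.prod_fiberwise _ (fun v => K.connectedComponentMk v)]
        refine Finset.prod_congr rfl fun c _ => Finset.prod_congr rfl fun v hv => ?_
        rw [(Finset.mem_filter.mp hv).2]
    _ = ∏ c : K.ConnectedComponent,
          ∑ s, ∏ v with K.connectedComponentMk v = c, ω (e v * s) := by
        rw [Finset.prod_univ_sum, Fintype.piFinset_univ]
    _ ≤ ∏ c : K.ConnectedComponent,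
          if #{v | K.connectedComponentMk v = c} < q then (3 : ℝ) else 1 :=
        Finset.prod_le_prod
          (fun c _ => Finset.sum_nonneg fun s _ => Finset.prod_nonneg fun v _ => hω0 _)
          fun c _ => component_sum_le hq hp hsum e he _
    _ = _ := by rw [Finset.prod_ite]; simp

/-- The graph `H` without the edges that meet `B`. -/
def isolate (H : SimpleGraph V) (B : Finset V) : SimpleGraph V where
  Adj x z := H.Adj x z ∧ x ∉ B ∧ z ∉ B
  symm := ⟨fun _ _ h => ⟨h.1.symm, h.2.2, h.2.1⟩⟩
  loopless := ⟨fun x h => H.loopless.irrefl x h.1⟩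

theorem consistent_of_defect_eq {H : SimpleGraph V} {σ : SignType} (hσ : σ = 1 ∨ σ = -1)
    {B : Finset V} {y : V → SignType} (hB : defect H σ y = B) (x z : V)
    (h : (isolate H B).Adj x z) : y z = σ * y x := by
  obtain ⟨hxz, hx, hz⟩ := h
  have key : ∀ u, u ∉ B → y u ≠ 0 → ∀ w, H.Adj u w → y w = σ * y u := by
    intro u hu hu0 w huw
    by_contra hne
    exact hu (by rw [← hB, defect, Finset.mem_filter]; exact ⟨Finset.mem_univ _, hu0, w, huw, hne⟩)
  by_cases hx0 : y x = 0
  · by_contra hne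
    have hz0 : y z ≠ 0 := fun h => hne (by rw [h, hx0, mul_zero])
    have := key z hz hz0 x hxz.symm
    rw [hx0] at this
    rcases hσ with rfl | rfl <;> simp [eq_comm] at this <;> exact hz0 this
  · exact key x hx hx0 z hxz

theorem card_small_components_le (H : SimpleGraph V) {Δ e q : ℕ} (hΔ : ∀ v, #{z | H.Adj v z} ≤ Δ)
    (he : #{v | #{u | H.Reachable v u} < q} ≤ e) (B : Finset V) :
    #{c : (isolate H B).ConnectedComponent |
      #{v | (isolate H B).connectedComponentMk v = c} < q} ≤ (Δ + 1) * #B + e := by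
  set K := isolate H B with hK
  set E : Finset V := {v | #{u | H.Reachable v u} < q} with hE
  set N : Finset V := B ∪ B.biUnion (fun v => {z | H.Adj v z}) with hN
  have hNc : #N ≤ (Δ + 1) * #B := by
    refine (Finset.card_union_le _ _).trans ?_
    have := Finset.card_biUnion_le_card_mul B (fun v => ({z | H.Adj v z} : Finset V)) Δ
      (fun v _ => hΔ v)
    nlinarith
  have hsub : ({c : K.ConnectedComponent | #{v | K.connectedComponentMk v = c} < q} : Finset _) ⊆
      (N ∪ E).image K.connectedComponentMk := by
    intro c hc
    rw [Finset.mem_filter] at hc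
    obtain ⟨v, rfl⟩ := c.exists_rep
    change _ ∧ #{u | K.connectedComponentMk u = K.connectedComponentMk v} < q at hc
    change K.connectedComponentMk v ∈ _
    by_contra hnot
    have hout : ∀ u, K.Reachable v u → u ∉ N ∪ E := fun u hu hmem => hnot
      (Finset.mem_image.mpr ⟨u, hmem, (SimpleGraph.ConnectedComponent.sound hu).symm⟩)
    have hstep : ∀ u, H.Reachable v u → K.Reachable v u := by
      rintro u hu
      rw [SimpleGraph.reachable_iff_reflTransGen] at hu
      induction hu with
      | refl => exact SimpleGraph.Reachable.refl _
      | @tail a b _ hab ih =>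
        refine ih.trans (SimpleGraph.Adj.reachable ?_)
        have ha := hout a ih
        simp only [hN, Finset.mem_union, Finset.mem_biUnion, Finset.mem_filter, Finset.mem_univ,
          true_and, not_or, not_exists, not_and] at ha
        exact ⟨hab, ha.1.1, fun hb => ha.1.2 b hb hab.symm⟩
    refine hout v (SimpleGraph.Reachable.refl _) (Finset.mem_union_right _ ?_)
    rw [hE, Finset.mem_filter]
    refine ⟨Finset.mem_univ _, lt_of_le_of_lt (Finset.card_le_card ?_) hc.2⟩
    intro u hu
    simp only [Finset.mem_filter, Finset.mem_univ, true_and] at hu ⊢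
    exact (SimpleGraph.ConnectedComponent.sound (hstep u hu)).symm
  calc _ ≤ #((N ∪ E).image K.connectedComponentMk) := Finset.card_le_card hsub
    _ ≤ #(N ∪ E) := Finset.card_image_le
    _ ≤ #N + #E := Finset.card_union_le _ _
    _ ≤ _ := by omega

/-- The number of labellings of type `m` with few defects. -/
theorem card_label_mul_rpow_le [Nonempty V] (H : SimpleGraph V) {σ : SignType}
    (hσ : σ = 1 ∨ σ = -1) {Δ e q : ℕ} (hq : 0 < q) (hΔ : ∀ v, #{z | H.Adj v z} ≤ Δ)
    (he : #{v | #{u | H.Reachable v u} < q} ≤ e) (m : SignType → ℕ) (d : ℕ) :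
    (#{y : V → SignType | labelCount y = m ∧ #(defect H σ y) ≤ d} : ℝ) *
        typeWeight (Fintype.card V) m ^ (1 / q : ℝ) ≤
      #{B : Finset V | #B ≤ d} * 3 ^ ((Δ + 1) * d + e) := by
  set T : Finset (V → SignType) := {y | labelCount y = m ∧ #(defect H σ y) ≤ d} with hT
  rcases T.eq_empty_or_nonempty with h0 | ⟨y₀, hy₀⟩
  · rw [h0]; simp
  have hn : (0 : ℝ) < Fintype.card V := by exact_mod_cast Fintype.card_pos
  set p : SignType → ℝ := fun s => (m s : ℝ) / Fintype.card V with hpdef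
  have hp : ∀ s, 0 ≤ p s := fun s => by positivity
  have hsum : ∑ s, p s = 1 := by
    have h1 : labelCount y₀ = m := (Finset.mem_filter.mp hy₀).2.1
    have h2 := sum_labelCount y₀
    rw [h1] at h2
    rw [← Finset.sum_div, div_eq_one_iff_eq hn.ne', ← h2]
    push_cast; rfl
  have hw : ∀ y ∈ T, ∏ v, p (y v) ^ (1 / q : ℝ) = typeWeight (Fintype.card V) m ^ (1 / q : ℝ) := by
    intro y hy
    have h1 : labelCount y = m := (Finset.mem_filter.mp hy).2.1
    rw [Real.finsetProd_rpow _ _ (fun v _ => hp _), prod_label, h1]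
    rfl
  have hmaps : ∀ y ∈ T, defect H σ y ∈ ({B : Finset V | #B ≤ d} : Finset (Finset V)) := by
    intro y hy
    rw [Finset.mem_filter]
    exact ⟨Finset.mem_univ _, (Finset.mem_filter.mp hy).2.2⟩
  calc (#T : ℝ) * typeWeight (Fintype.card V) m ^ (1 / q : ℝ)
      = ∑ y ∈ T, ∏ v, p (y v) ^ (1 / q : ℝ) := by
        rw [Finset.sum_congr rfl hw, Finset.sum_const, nsmul_eq_mul]
    _ = ∑ B : Finset V with #B ≤ d, ∑ y ∈ T with defect H σ y = B,
          ∏ v, p (y v) ^ (1 / q : ℝ) := (Finset.sum_fiberwise_of_maps_to hmaps _).symm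
    _ ≤ ∑ B : Finset V with #B ≤ d, (3 : ℝ) ^ ((Δ + 1) * d + e) := by
        refine Finset.sum_le_sum fun B hB => ?_
        have hBd : #B ≤ d := (Finset.mem_filter.mp hB).2
        refine le_trans (Finset.sum_le_sum_of_subset_of_nonneg ?_ ?_)
          ((sum_consistent_le (isolate H B) hσ hq hp hsum).trans
            (pow_le_pow_right₀ (by norm_num)
              ((card_small_components_le H hΔ he B).trans ?_)))
        · intro y hy
          rw [Finset.mem_filter] at hy ⊢
          exact ⟨Finset.mem_univ _, consistent_of_defect_eq hσ hy.2⟩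
        · exact fun y _ _ => Finset.prod_nonneg fun v _ => Real.rpow_nonneg (hp _) _
        · gcongr
    _ = _ := by rw [Finset.sum_const, nsmul_eq_mul]

end Counting

section Matching

open scoped Classical

variable {V : Type*}

/-- The image of a subgraph of the complete graph under the inverse of a permutation. -/
def permute (π : Equiv.Perm V) (M : (⊤ : SimpleGraph V).Subgraph) :
    (⊤ : SimpleGraph V).Subgraph where
  verts := π ⁻¹' M.verts
  Adj x z := M.Adj (π x) (π z)
  adj_sub h := by
    have := M.adj_sub h
    simpa using this
  edge_vert h := M.edge_vert h
  symm := ⟨fun _ _ h => M.symm.symm _ _ h⟩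

theorem permute_symm_permute (π : Equiv.Perm V) (M : (⊤ : SimpleGraph V).Subgraph) :
    permute π.symm (permute π M) = M := by
  ext <;> simp [permute]

theorem permute_permute_symm (π : Equiv.Perm V) (M : (⊤ : SimpleGraph V).Subgraph) :
    permute π (permute π.symm M) = M := by
  ext <;> simp [permute]

variable [Fintype V]

theorem IsNearPerfectMatching.permute {M : (⊤ : SimpleGraph V).Subgraph}
    (hM : IsNearPerfectMatching M) (π : Equiv.Perm V) : IsNearPerfectMatching (permute π M) := by
  refine ⟨fun v hv => ?_, ?_⟩
  · obtain ⟨w, hw, huniq⟩ := hM.1 (v := π v) hv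
    refine ⟨π.symm w, by simpa [_root_.permute] using hw, fun u hu => ?_⟩
    rw [← huniq (π u) hu, Equiv.symm_apply_apply]
  · rw [← hM.2]
    change (π ⁻¹' M.verts)ᶜ.ncard = _
    rw [← Set.preimage_compl, ← Equiv.image_symm_eq_preimage]
    exact Set.ncard_image_of_injective _ π.symm.injective

theorem card_defect_permute (π : Equiv.Perm V) (M : (⊤ : SimpleGraph V).Subgraph) (σ : SignType)
    (y : V → SignType) :
    #(defect (permute π M).spanningCoe σ (y ∘ π)) = #(defect M.spanningCoe σ y) := by
  refine Finset.card_equiv π fun x => ?_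
  simp only [defect, Finset.mem_filter, Finset.mem_univ, true_and, Function.comp_apply,
    SimpleGraph.Subgraph.spanningCoe_adj]
  refine and_congr_right fun _ => ⟨?_, ?_⟩
  · rintro ⟨z, hz, h⟩
    exact ⟨π z, hz, h⟩
  · rintro ⟨z, hz, h⟩
    exact ⟨π.symm z, by simpa [permute] using hz, by simpa using h⟩

/-- The set of near-perfect matchings, as a finset. -/
noncomputable def nearMatchings (V : Type*) [Fintype V] :
    Finset ((⊤ : SimpleGraph V).Subgraph) :=
  (Set.toFinite {M : (⊤ : SimpleGraph V).Subgraph | IsNearPerfectMatching M}).toFinset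

theorem mem_nearMatchings {M : (⊤ : SimpleGraph V).Subgraph} :
    M ∈ nearMatchings V ↔ IsNearPerfectMatching M := by
  simp [nearMatchings]

theorem card_perm_comp_eq_le (y y' : V → SignType) :
    #{π : Equiv.Perm V | y ∘ π = y'} ≤ ∏ s, (labelCount y s).factorial := by
  rcases ({π : Equiv.Perm V | y ∘ π = y'} : Finset _).eq_empty_or_nonempty with h0 | ⟨π₀, h₀⟩
  · rw [h0]; simp
  · have h₀ : y ∘ π₀ = y' := by simpa using h₀
    have h1 := DomMulAct.stabilizer_card y
    have h2 : ∀ s, Fintype.card {a // y a = s} = labelCount y s := fun s => by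
      rw [Fintype.card_subtype, labelCount]
    simp only [h2, Fintype.card_subtype] at h1
    rw [← h1]
    refine Finset.card_le_card_of_injOn (fun π => π * π₀⁻¹) ?_ (fun a _ b _ h => mul_right_cancel h)
    intro π hπ
    simp only [Finset.coe_filter, Finset.mem_univ, true_and, Set.mem_ofPred_eq] at hπ ⊢
    rw [Equiv.Perm.coe_mul, ← Function.comp_assoc, hπ, ← h₀, Function.comp_assoc,
      ← Equiv.Perm.coe_mul, mul_inv_cancel]
    rfl

/-- If every near-perfect matching has few labellings of a given type with few defects, then every
labelling of that type has few near-perfect matchings with few defects. -/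
theorem card_matching_mul_factorial_le (σ : SignType) (y : V → SignType) (d : ℕ) {b : ℝ}
    (hb : ∀ M ∈ nearMatchings V, (#{y' : V → SignType | labelCount y' = labelCount y ∧
      #(defect M.spanningCoe σ y') ≤ d} : ℝ) ≤ b) :
    (#{M ∈ nearMatchings V | #(defect M.spanningCoe σ y) ≤ d} : ℝ) * (Fintype.card V).factorial ≤
      #(nearMatchings V) * (b * ∏ s, ((labelCount y s).factorial : ℝ)) := by
  have hconst : ∀ π : Equiv.Perm V,
      #{M ∈ nearMatchings V | #(defect M.spanningCoe σ (y ∘ π)) ≤ d} =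
        #{M ∈ nearMatchings V | #(defect M.spanningCoe σ y) ≤ d} := by
    intro π
    refine Finset.card_bij' (fun M _ => permute π.symm M) (fun M _ => permute π M) ?_ ?_
      (fun M _ => permute_permute_symm π M) (fun M _ => permute_symm_permute π M)
    · intro M hM
      rw [Finset.mem_filter, mem_nearMatchings] at hM ⊢
      refine ⟨hM.1.permute _, ?_⟩
      rw [← card_defect_permute π, permute_permute_symm]
      exact hM.2
    · intro M hM
      rw [Finset.mem_filter, mem_nearMatchings] at hM ⊢
      refine ⟨hM.1.permute _, ?_⟩
      rw [card_defect_permute π]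
      exact hM.2
  have hdouble := Finset.sum_card_bipartiteAbove_eq_sum_card_bipartiteBelow
    (fun (π : Equiv.Perm V) (M : (⊤ : SimpleGraph V).Subgraph) =>
      #(defect M.spanningCoe σ (y ∘ π)) ≤ d) (s := Finset.univ) (t := nearMatchings V)
  simp only [Finset.bipartiteAbove, Finset.bipartiteBelow, hconst, Finset.sum_const,
    Finset.card_univ, Fintype.card_perm, smul_eq_mul] at hdouble
  have hM : ∀ M ∈ nearMatchings V,
      (#{π : Equiv.Perm V | #(defect M.spanningCoe σ (y ∘ π)) ≤ d} : ℝ) ≤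
        b * ∏ s, ((labelCount y s).factorial : ℝ) := by
    intro M hM
    have h1 : #{π : Equiv.Perm V | #(defect M.spanningCoe σ (y ∘ π)) ≤ d} ≤
        (∏ s, (labelCount y s).factorial) * #{y' : V → SignType | labelCount y' = labelCount y ∧
          #(defect M.spanningCoe σ y') ≤ d} := by
      refine Finset.card_le_mul_card_image_of_maps_to (f := fun π : Equiv.Perm V => y ∘ π) ?_ _ ?_
      · intro π hπ
        simp only [Finset.mem_filter, Finset.mem_univ, true_and] at hπ ⊢
        refine ⟨?_, hπ⟩
        ext s
        exact Finset.card_equiv π (by simp)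
      · intro y' _
        refine (Finset.card_le_card ?_).trans (card_perm_comp_eq_le y y')
        intro π hπ
        simp only [Finset.mem_filter, Finset.mem_univ, true_and] at hπ ⊢
        exact hπ.2
    calc (#{π : Equiv.Perm V | #(defect M.spanningCoe σ (y ∘ π)) ≤ d} : ℝ)
        ≤ (∏ s, ((labelCount y s).factorial : ℝ)) * #{y' : V → SignType |
            labelCount y' = labelCount y ∧ #(defect M.spanningCoe σ y') ≤ d} := by
          exact_mod_cast h1
      _ ≤ (∏ s, ((labelCount y s).factorial : ℝ)) * b :=
          mul_le_mul_of_nonneg_left (hb M hM) (by positivity)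
      _ = _ := mul_comm _ _
  calc _ = ((∑ M ∈ nearMatchings V,
        #{π : Equiv.Perm V | #(defect M.spanningCoe σ (y ∘ π)) ≤ d} : ℕ) : ℝ) := by
        rw [← hdouble]; push_cast; ring
    _ ≤ _ := by
        push_cast
        refine (Finset.sum_le_sum hM).trans ?_
        rw [Finset.sum_const, nsmul_eq_mul]

theorem IsNearPerfectMatching.degree_le {M : (⊤ : SimpleGraph V).Subgraph}
    (hM : IsNearPerfectMatching M) (v : V) : #{z | M.spanningCoe.Adj v z} ≤ 1 := by
  rw [Finset.card_le_one]
  intro a ha b hb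
  simp only [Finset.mem_filter, Finset.mem_univ, true_and,
    SimpleGraph.Subgraph.spanningCoe_adj] at ha hb
  exact (hM.1 (M.edge_vert ha)).unique ha hb

theorem IsNearPerfectMatching.card_unmatched_le {M : (⊤ : SimpleGraph V).Subgraph}
    (hM : IsNearPerfectMatching M) : #{v | v ∉ M.verts} ≤ 1 := by
  have h := hM.2
  rw [Set.ncard_eq_toFinset_card'] at h
  have h1 : M.vertsᶜ.toFinset = ({v | v ∉ M.verts} : Finset V) := by ext; simp
  rw [h1] at h
  omega

theorem IsNearPerfectMatching.card_isolated_le {M : (⊤ : SimpleGraph V).Subgraph}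
    (hM : IsNearPerfectMatching M) :
    #{v | #{u | M.spanningCoe.Reachable v u} < 2} ≤ 1 := by
  refine le_trans (Finset.card_le_card fun v hv => ?_) hM.card_unmatched_le
  simp only [Finset.mem_filter, Finset.mem_univ, true_and] at hv ⊢
  intro hvM
  obtain ⟨w, hw, -⟩ := hM.1 hvM
  have hw' : M.spanningCoe.Adj v w := hw
  refine absurd hv (not_lt.mpr ?_)
  rw [← Nat.lt_iff_add_one_le, Finset.one_lt_card]
  exact ⟨v, by simp, w, by simpa using hw'.reachable, hw'.ne⟩

/-- The number of near-perfect matchings that almost respect a given labelling. -/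
theorem card_matching_le [Nonempty V] {σ : SignType} (hσ : σ = 1 ∨ σ = -1) (y : V → SignType)
    (d : ℕ) (hw : 0 < typeWeight (Fintype.card V) (labelCount y)) :
    (#{M ∈ nearMatchings V | #(defect M.spanningCoe σ y) ≤ d} : ℝ) * (Fintype.card V).factorial *
        typeWeight (Fintype.card V) (labelCount y) ^ (1 / 2 : ℝ) ≤
      #(nearMatchings V) * ((#{B : Finset V | #B ≤ d} * 3 ^ (2 * d + 1)) *
        ∏ s, ((labelCount y s).factorial : ℝ)) := by
  have hw2 := Real.rpow_pos_of_pos hw (1 / 2 : ℝ)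
  have h := card_matching_mul_factorial_le σ y d
    (b := #{B : Finset V | #B ≤ d} * 3 ^ (2 * d + 1) /
      typeWeight (Fintype.card V) (labelCount y) ^ (1 / 2 : ℝ)) (fun M hM => by
      rw [mem_nearMatchings] at hM
      rw [le_div_iff₀ hw2]
      have := card_label_mul_rpow_le M.spanningCoe hσ (q := 2) two_pos hM.degree_le
        hM.card_isolated_le (labelCount y) d
      simpa using this)
  rw [← le_div_iff₀ hw2]
  refine h.trans (le_of_eq ?_)
  ring

end Matching

section Estimates

/-- The ratio of `k!` to `(k / e) ^ k`. -/
noncomputable def factorialRatio (k : ℕ) : ℝ := k.factorial * Real.exp k / (k : ℝ) ^ k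

theorem pow_self_pos (k : ℕ) : (0 : ℝ) < (k : ℝ) ^ k := by
  rcases k.eq_zero_or_pos with rfl | h
  · simp
  · positivity

theorem factorialRatio_pos (k : ℕ) : 0 < factorialRatio k :=
  div_pos (by positivity) (pow_self_pos k)

theorem factorial_eq_factorialRatio (k : ℕ) :
    (k.factorial : ℝ) = factorialRatio k * (k : ℝ) ^ k * Real.exp (-k) := by
  have := (pow_self_pos k).ne'
  rw [factorialRatio, Real.exp_neg]
  field_simp

theorem factorialRatio_mono : Monotone factorialRatio := by
  refine monotone_nat_of_le_succ fun k => ?_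
  have h1 : ((k + 1 : ℕ) : ℝ) ^ k ≤ Real.exp 1 * (k : ℝ) ^ k := by
    rcases k.eq_zero_or_pos with rfl | h
    · simp
    · have hk : (0 : ℝ) < k := by exact_mod_cast h
      have h2 : ((k + 1 : ℕ) : ℝ) ≤ k * Real.exp (1 / k) := by
        have := Real.add_one_le_exp (1 / (k : ℝ))
        have := mul_le_mul_of_nonneg_left this hk.le
        push_cast
        calc (k : ℝ) + 1 = k * (1 / k + 1) := by field_simp; ring
          _ ≤ _ := this
      calc ((k + 1 : ℕ) : ℝ) ^ k ≤ (k * Real.exp (1 / k)) ^ k := by gcongr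
        _ = Real.exp 1 * (k : ℝ) ^ k := by
          rw [mul_pow, ← Real.exp_nat_mul, mul_one_div_cancel hk.ne', mul_comm]
  rw [factorialRatio, factorialRatio, div_le_div_iff₀ (pow_self_pos k) (pow_self_pos (k + 1)),
    Nat.factorial_succ, pow_succ]
  push_cast at h1 ⊢
  rw [Real.exp_add]
  have : (0 : ℝ) ≤ k.factorial * Real.exp k * (k + 1) := by positivity
  nlinarith [mul_le_mul_of_nonneg_left h1 this]

theorem factorialRatio_succ_le (k : ℕ) : factorialRatio (k + 1) ≤ Real.exp 1 * (k + 1) := by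
  induction k with
  | zero => simp [factorialRatio]
  | succ k ih =>
    have h1 : Real.exp 1 * ((k : ℝ) + 1) ^ (k + 2) ≤ ((k : ℝ) + 2) ^ (k + 2) := by
      have h2 := Real.add_one_le_exp (-(1 / ((k : ℝ) + 2)))
      have h3 : (k : ℝ) + 1 ≤ (k + 2) * Real.exp (-(1 / ((k : ℝ) + 2))) := by
        calc (k : ℝ) + 1 = (k + 2) * (-(1 / ((k : ℝ) + 2)) + 1) := by field_simp; ring
          _ ≤ _ := mul_le_mul_of_nonneg_left h2 (by positivity)
      have h4 := pow_le_pow_left₀ (by positivity) h3 (k + 2)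
      have h5 : Real.exp (-(1 / ((k : ℝ) + 2))) ^ (k + 2) = Real.exp (-1) := by
        rw [← Real.exp_nat_mul]
        congr 1
        push_cast
        field_simp
      rw [mul_pow, h5] at h4
      calc Real.exp 1 * ((k : ℝ) + 1) ^ (k + 2) ≤
          Real.exp 1 * (((k : ℝ) + 2) ^ (k + 2) * Real.exp (-1)) := by gcongr
        _ = _ := by
          rw [mul_comm (((k : ℝ) + 2) ^ (k + 2)), ← mul_assoc, ← Real.exp_add]; simp
    have h6 : factorialRatio (k + 1 + 1) ≤ factorialRatio (k + 1) * ((k + 2) / (k + 1)) := by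
      rw [factorialRatio, factorialRatio, div_mul_div_comm,
        div_le_div_iff₀ (pow_self_pos _) (mul_pos (pow_self_pos _) (by positivity)),
        Nat.factorial_succ (k + 1)]
      push_cast
      have e1 : (k : ℝ) + 1 + 1 = k + 2 := by ring
      have e2 : Real.exp (k + 1 + 1) = Real.exp (k + 1) * Real.exp 1 := Real.exp_add _ _
      rw [e2, e1]
      have h7 : (0 : ℝ) ≤ ((k : ℝ) + 2) * (k + 1).factorial * Real.exp (k + 1) := by positivity
      have h8 := mul_le_mul_of_nonneg_left h1 h7
      calc _ = ((k : ℝ) + 2) * (k + 1).factorial * Real.exp (k + 1) *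
            (Real.exp 1 * ((k : ℝ) + 1) ^ (k + 2)) := by ring
        _ ≤ _ := h8
        _ = _ := by ring
    have h9 : (0 : ℝ) ≤ ((k : ℝ) + 2) / (k + 1) := by positivity
    calc _ ≤ _ := h6
      _ ≤ Real.exp 1 * (k + 1) * ((k + 2) / (k + 1)) := mul_le_mul_of_nonneg_right ih h9
      _ = _ := by push_cast; field_simp; ring

theorem factorialRatio_le (k : ℕ) : factorialRatio k ≤ Real.exp 1 * (k + 1) := by
  rcases k with _ | k
  · simp [factorialRatio]
  · refine (factorialRatio_succ_le k).trans ?_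
    push_cast
    gcongr
    linarith

theorem typeWeight_eq (n : ℕ) (m : SignType → ℕ) (hm : ∑ s, m s = n) :
    typeWeight n m = (∏ s, (m s : ℝ) ^ m s) / (n : ℝ) ^ n := by
  rw [typeWeight, ← hm, ← Finset.prod_pow_eq_pow_sum, ← Finset.prod_div_distrib]
  simp only [div_pow]

theorem typeWeight_pos {n : ℕ} {m : SignType → ℕ} (hm : ∑ s, m s = n) : 0 < typeWeight n m := by
  rw [typeWeight_eq n m hm]
  exact div_pos (Finset.prod_pos fun s _ => pow_self_pos _) (pow_self_pos n)

/-- A lower bound for multinomial coefficients. -/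
theorem prod_factorial_le {n : ℕ} {m : SignType → ℕ} (hm : ∑ s, m s = n) :
    ∏ s, ((m s).factorial : ℝ) ≤ n.factorial * typeWeight n m *
      (Real.exp 1 ^ 2 * ((m 1 + m (-1) : ℝ) + 1) ^ 2) := by
  have h1 : ∏ s, ((m s).factorial : ℝ) =
      (∏ s, factorialRatio (m s)) * (∏ s, (m s : ℝ) ^ m s) * Real.exp (-n) := by
    simp only [factorial_eq_factorialRatio, Finset.prod_mul_distrib]
    rw [← Real.exp_sum, Finset.sum_neg_distrib, ← hm]
    push_cast
    rfl
  have h2 : (n.factorial : ℝ) * typeWeight n m =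
      factorialRatio n * (∏ s, (m s : ℝ) ^ m s) * Real.exp (-n) := by
    rw [factorial_eq_factorialRatio, typeWeight_eq n m hm]
    have := (pow_self_pos n).ne'
    field_simp
  have h0 : m 0 ≤ n := by rw [← hm]; exact Finset.single_le_sum (fun _ _ => Nat.zero_le _) (Finset.mem_univ _)
  have h3 : ∏ s, factorialRatio (m s) ≤ factorialRatio n *
      (Real.exp 1 ^ 2 * ((m 1 + m (-1) : ℝ) + 1) ^ 2) := by
    rw [prod_signType]
    have e0 := factorialRatio_mono h0
    have e1 : factorialRatio (m 1) ≤ Real.exp 1 * ((m 1 + m (-1) : ℝ) + 1) :=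
      (factorialRatio_le _).trans (by gcongr; simp)
    have e2 : factorialRatio (m (-1)) ≤ Real.exp 1 * ((m 1 + m (-1) : ℝ) + 1) :=
      (factorialRatio_le _).trans (by gcongr; simp)
    have p0 := (factorialRatio_pos (m 0)).le
    have p1 := (factorialRatio_pos (m 1)).le
    have p2 := (factorialRatio_pos (m (-1))).le
    have pn := (factorialRatio_pos n).le
    calc _ ≤ factorialRatio n * (Real.exp 1 * ((m 1 + m (-1) : ℝ) + 1)) *
          (Real.exp 1 * ((m 1 + m (-1) : ℝ) + 1)) := by gcongr
      _ = _ := by ring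
  rw [h1, h2]
  have h4 : 0 ≤ (∏ s, (m s : ℝ) ^ m s) * Real.exp (-n) :=
    mul_nonneg (Finset.prod_nonneg fun s _ => (pow_self_pos _).le) (Real.exp_pos _).le
  nlinarith [mul_le_mul_of_nonneg_right h3 h4]

/-- Upper bounds for the weight of a type in which no nonzero label has density over `3 / 4`. -/
theorem typeWeight_le {n : ℕ} {m : SignType → ℕ} (hm : ∑ s, m s = n) (hn : 0 < n)
    (h1 : 4 * m 1 ≤ 3 * n) (h2 : 4 * m (-1) ≤ 3 * n) :
    typeWeight n m ≤ (3 / 4 : ℝ) ^ ((m 1 + m (-1) : ℝ) / 2) ∧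
    typeWeight n m ≤ ((m 1 + m (-1) : ℝ) / n) ^ ((m 1 + m (-1) : ℝ) / 2) := by
  have hn' : (0 : ℝ) < n := by exact_mod_cast hn
  have hms : ∀ s, m s ≤ n := fun s => by
    rw [← hm]; exact Finset.single_le_sum (fun _ _ => Nat.zero_le _) (Finset.mem_univ _)
  have hf0 : ∀ s, 0 ≤ ((m s : ℝ) / n) ^ m s := fun s => by positivity
  have hf1 : ∀ s, ((m s : ℝ) / n) ^ m s ≤ 1 := fun s =>
    pow_le_one₀ (by positivity) (div_le_one_of_le₀ (by exact_mod_cast hms s) hn'.le)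
  have hfac : ∀ s, typeWeight n m ≤ ((m s : ℝ) / n) ^ m s := fun s => by
    rw [typeWeight, ← Finset.mul_prod_erase _ _ (Finset.mem_univ s)]
    exact mul_le_of_le_one_right (hf0 s) (Finset.prod_le_one (fun i _ => hf0 i) fun i _ => hf1 i)
  have hsum : (m 1 + m (-1) : ℝ) ≤ n := by
    have := sum_signType m
    rw [hm] at this
    have : m 1 + m (-1) ≤ n := by omega
    exact_mod_cast this
  have key : ∀ s, (m 1 + m (-1) : ℝ) / 2 ≤ m s → (m s : ℝ) ≤ m 1 + m (-1) →
      4 * m s ≤ 3 * n → typeWeight n m ≤ (3 / 4 : ℝ) ^ ((m 1 + m (-1) : ℝ) / 2) ∧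
    typeWeight n m ≤ ((m 1 + m (-1) : ℝ) / n) ^ ((m 1 + m (-1) : ℝ) / 2) := by
    intro s hs hs' hs4
    have hs4 : (4 * m s : ℝ) ≤ 3 * n := by exact_mod_cast hs4
    constructor
    · calc _ ≤ ((m s : ℝ) / n) ^ m s := hfac s
        _ ≤ (3 / 4 : ℝ) ^ m s := by
          refine pow_le_pow_left₀ (by positivity) ?_ _
          rw [div_le_iff₀ hn']; linarith
        _ = (3 / 4 : ℝ) ^ (m s : ℝ) := (Real.rpow_natCast _ _).symm
        _ ≤ _ := Real.rpow_le_rpow_of_exponent_ge (by norm_num) (by norm_num) hs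
    · rcases (m s).eq_zero_or_pos with h0 | h0
      · have e : (m 1 + m (-1) : ℝ) = 0 := by
          have : (m s : ℝ) = 0 := by exact_mod_cast h0
          have : (0 : ℝ) ≤ m 1 + m (-1) := by positivity
          linarith
        rw [e]
        simpa [h0] using hfac s
      · have h0' : (0 : ℝ) < m s := by exact_mod_cast h0
        calc _ ≤ ((m s : ℝ) / n) ^ m s := hfac s
          _ ≤ ((m 1 + m (-1) : ℝ) / n) ^ m s := by gcongr
          _ = ((m 1 + m (-1) : ℝ) / n) ^ (m s : ℝ) := (Real.rpow_natCast _ _).symm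
          _ ≤ _ := Real.rpow_le_rpow_of_exponent_ge (div_pos (by linarith) hn')
            ((div_le_one hn').mpr hsum) hs
  have q1 : (0 : ℝ) ≤ m 1 := by positivity
  have q2 : (0 : ℝ) ≤ m (-1) := by positivity
  rcases le_total (m 1 : ℝ) (m (-1)) with h | h
  · exact key (-1) (by linarith) (by linarith) h2
  · exact key 1 (by linarith) (by linarith) h1

open scoped Classical in
theorem card_small_subsets_le (V : Type*) [Fintype V] {θ : ℝ} (h0 : 0 < θ) (h1 : θ ≤ 1)
    {d : ℕ} {a : ℝ} (hd : (d : ℝ) ≤ a) :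
    (#{B : Finset V | #B ≤ d} : ℝ) ≤ Real.exp (θ * Fintype.card V - a * Real.log θ) := by
  have hθ : (#{B : Finset V | #B ≤ d} : ℝ) * θ ^ d ≤ (1 + θ) ^ Fintype.card V := by
    have h2 := Finset.sum_pow_mul_eq_add_pow θ 1 (Finset.univ : Finset V)
    simp only [one_pow, mul_one, Finset.powerset_univ, Finset.card_univ] at h2
    rw [add_comm 1 θ, ← h2]
    calc (#{B : Finset V | #B ≤ d} : ℝ) * θ ^ d = ∑ B : Finset V with #B ≤ d, θ ^ d := by
          rw [Finset.sum_const, nsmul_eq_mul]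
      _ ≤ ∑ B : Finset V with #B ≤ d, θ ^ #B := Finset.sum_le_sum fun B hB =>
          pow_le_pow_of_le_one h0.le h1 (Finset.mem_filter.mp hB).2
      _ ≤ ∑ B : Finset V, θ ^ #B := Finset.sum_le_sum_of_subset_of_nonneg (Finset.subset_univ _)
          fun _ _ _ => by positivity
  have h3 : (1 + θ) ^ Fintype.card V ≤ Real.exp (θ * Fintype.card V) := by
    rw [mul_comm, Real.exp_nat_mul]
    gcongr
    rw [add_comm]
    exact Real.add_one_le_exp θ
  have h4 : Real.exp (a * Real.log θ) ≤ θ ^ d := by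
    rw [← Real.exp_log h0, ← Real.exp_nat_mul, Real.log_exp]
    apply Real.exp_le_exp.mpr
    exact mul_le_mul_of_nonpos_right hd (Real.log_nonpos h0.le h1)
  rw [Real.exp_sub, le_div_iff₀ (Real.exp_pos _)]
  calc _ ≤ (#{B : Finset V | #B ≤ d} : ℝ) * θ ^ d := by gcongr
    _ ≤ _ := hθ.trans h3

/-- The exponential rate of the union bound at defect density `δ`. -/
noncomputable def unionRate (Δ : ℕ) (δ : ℝ) : ℝ :=
  2 * δ - 2 * (δ * Real.log δ) + (Δ + 3) * δ * Real.log 3 - Real.log (4 / 3) / 24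

theorem exists_unionRate_neg (Δ : ℕ) : ∃ δ : ℝ, 0 < δ ∧ δ ≤ 1 / 96 ∧ unionRate Δ δ < 0 := by
  have hc : Continuous (unionRate Δ) := by
    unfold unionRate
    have := Real.continuous_mul_log
    fun_prop
  have h0 : unionRate Δ 0 < 0 := by
    have := Real.log_pos (show (1 : ℝ) < 4 / 3 by norm_num)
    simp only [unionRate]
    norm_num
    linarith
  have h1 : ∀ᶠ δ in nhdsWithin (0 : ℝ) (Set.Ioi 0), unionRate Δ δ < 0 :=
    (hc.continuousAt.eventually (gt_mem_nhds h0)).filter_mono nhdsWithin_le_nhds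
  have h2 : ∀ᶠ δ in nhdsWithin (0 : ℝ) (Set.Ioi 0), δ ∈ Set.Ioc (0 : ℝ) (1 / 96) :=
    Ioc_mem_nhdsGT (by norm_num)
  obtain ⟨δ, hδ, hδ'⟩ := (h1.and h2).exists
  exact ⟨δ, hδ'.1, hδ'.2, hδ⟩

theorem union_term_le {Δ n s d : ℕ} {δ w b : ℝ} (hδ : 0 < δ) (hδ' : δ ≤ 1 / 96) (hs : 0 < s)
    (hsn : s ≤ n) (hd : (d : ℝ) ≤ δ * s)
    (hb0 : 0 ≤ b) (hb : b ≤ Real.exp (δ * s / n * n - δ * s * Real.log (δ * s / n))) (hw : 0 < w)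
    (hw1 : w ≤ (3 / 4 : ℝ) ^ ((s : ℝ) / 2)) (hw2 : w ≤ ((s : ℝ) / n) ^ ((s : ℝ) / 2)) :
    b ^ 2 * 3 ^ ((Δ + 3) * d + 1) * w ^ (1 / 6 : ℝ) ≤
      3 * ((s + 1) * Real.exp (unionRate Δ δ) ^ s * (n : ℝ) ^ (-(1 / 48) : ℝ)) := by
  have hs' : (0 : ℝ) < s := by exact_mod_cast hs
  have hs1 : (1 : ℝ) ≤ s := by exact_mod_cast hs
  have hn' : (0 : ℝ) < n := by exact_mod_cast hs.trans_le hsn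
  have hsn' : (s : ℝ) ≤ n := by exact_mod_cast hsn
  set L := Real.log ((s : ℝ) / n) with hL
  have hL0 : L ≤ 0 := Real.log_nonpos (by positivity) ((div_le_one hn').mpr hsn')
  have e1 : b ^ 2 ≤ Real.exp (2 * (δ * s - δ * s * (Real.log δ + L))) := by
    have h1 : δ * s / n * n - δ * s * Real.log (δ * s / n) = δ * s - δ * s * (Real.log δ + L) := by
      rw [div_mul_cancel₀ _ hn'.ne', mul_div_assoc, Real.log_mul hδ.ne' (by positivity)]
    rw [h1] at hb
    calc b ^ 2 ≤ Real.exp (δ * s - δ * s * (Real.log δ + L)) ^ 2 := by gcongr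
      _ = _ := by rw [← Real.exp_nat_mul]; norm_num
  have e2 : (3 : ℝ) ^ ((Δ + 3) * d + 1) ≤ 3 * Real.exp ((Δ + 3) * δ * Real.log 3 * s) := by
    have h3 : (0 : ℝ) < Real.log 3 := Real.log_pos (by norm_num)
    rw [pow_succ, mul_comm]
    gcongr
    calc (3 : ℝ) ^ ((Δ + 3) * d) = Real.exp (Real.log 3) ^ ((Δ + 3) * d) := by
          rw [Real.exp_log (by norm_num)]
      _ = Real.exp (((Δ + 3) * d : ℕ) * Real.log 3) := (Real.exp_nat_mul _ _).symm
      _ ≤ _ := by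
        apply Real.exp_le_exp.mpr
        push_cast
        calc ((Δ : ℝ) + 3) * d * Real.log 3 ≤ (Δ + 3) * (δ * s) * Real.log 3 := by gcongr
          _ = _ := by ring
  have e3 : w ^ (1 / 6 : ℝ) ≤ Real.exp (-(s * (Real.log (4 / 3) / 24)) + s / 24 * L) := by
    have h1 : w ^ (1 / 12 : ℝ) ≤ Real.exp (-(s * (Real.log (4 / 3) / 24))) := by
      calc w ^ (1 / 12 : ℝ) ≤ ((3 / 4 : ℝ) ^ ((s : ℝ) / 2)) ^ (1 / 12 : ℝ) := by gcongr
        _ = _ := by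
          rw [← Real.rpow_mul (by norm_num), Real.rpow_def_of_pos (by norm_num),
            show (3 / 4 : ℝ) = (4 / 3)⁻¹ by norm_num, Real.log_inv]
          congr 1; ring
    have h2 : w ^ (1 / 12 : ℝ) ≤ Real.exp (s / 24 * L) := by
      calc w ^ (1 / 12 : ℝ) ≤ (((s : ℝ) / n) ^ ((s : ℝ) / 2)) ^ (1 / 12 : ℝ) := by gcongr
        _ = _ := by
          rw [← Real.rpow_mul (by positivity), Real.rpow_def_of_pos (by positivity)]
          congr 1; rw [hL]; ring
    rw [show (1 / 6 : ℝ) = 1 / 12 + 1 / 12 by norm_num, Real.rpow_add hw, Real.exp_add]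
    gcongr
  have e4 : Real.exp (L / 48) ≤ (s + 1) * (n : ℝ) ^ (-(1 / 48) : ℝ) := by
    have h1 : Real.exp (L / 48) = ((s : ℝ) / n) ^ (1 / 48 : ℝ) := by
      rw [Real.rpow_def_of_pos (by positivity)]
      congr 1; rw [hL]; ring
    rw [h1, Real.div_rpow hs'.le hn'.le, Real.rpow_neg hn'.le, div_eq_mul_inv]
    gcongr
    calc (s : ℝ) ^ (1 / 48 : ℝ) ≤ (s : ℝ) ^ (1 : ℝ) :=
          Real.rpow_le_rpow_of_exponent_le hs1 (by norm_num)
      _ ≤ _ := by rw [Real.rpow_one]; linarith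
  calc b ^ 2 * 3 ^ ((Δ + 3) * d + 1) * w ^ (1 / 6 : ℝ)
      ≤ Real.exp (2 * (δ * s - δ * s * (Real.log δ + L))) *
        (3 * Real.exp ((Δ + 3) * δ * Real.log 3 * s)) *
        Real.exp (-(s * (Real.log (4 / 3) / 24)) + s / 24 * L) := by gcongr
    _ = 3 * Real.exp (s * unionRate Δ δ + s * (1 / 24 - 2 * δ) * L) := by
        rw [mul_left_comm, mul_assoc, ← Real.exp_add, ← Real.exp_add]
        congr 2
        rw [unionRate]; ring
    _ ≤ 3 * Real.exp (s * unionRate Δ δ + L / 48) := by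
        gcongr 3 * Real.exp (_ + ?_)
        have : 1 / 48 ≤ s * (1 / 24 - 2 * δ) := by nlinarith
        nlinarith
    _ = 3 * (Real.exp (unionRate Δ δ) ^ s * Real.exp (L / 48)) := by
        rw [Real.exp_add, ← Real.exp_nat_mul]
    _ ≤ 3 * (Real.exp (unionRate Δ δ) ^ s * ((s + 1) * (n : ℝ) ^ (-(1 / 48) : ℝ))) := by gcongr
    _ = _ := by ring

theorem summable_cube_mul_geometric {κ : ℝ} (h0 : 0 ≤ κ) (h1 : κ < 1) :
    Summable fun a : ℕ => ((a : ℝ) + 1) ^ 3 * κ ^ a := by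
  have h := fun k => summable_pow_mul_geometric_of_norm_lt_one (R := ℝ) k
    (r := κ) (by rwa [Real.norm_of_nonneg h0])
  refine (((h 3).add ((h 2).mul_left 3)).add (((h 1).mul_left 3).add (h 0))).congr fun a => ?_
  ring

end Estimates

section UnionBound

open scoped Classical

variable {V : Type*} [Fintype V]

theorem sum_card_matching_le [Nonempty V] (G : SimpleGraph V) {Δ : ℕ}
    (hΔ : ∀ v, #{z | G.Adj v z} ≤ Δ) (hG : ∀ v, 3 ≤ #{u | G.Reachable v u})
    {σ : SignType} (hσ : σ = 1 ∨ σ = -1) {δ : ℝ} (hδ : 0 < δ) (hδ' : δ ≤ 1 / 96)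
    {m : SignType → ℕ} (hm : ∑ s, m s = Fintype.card V) {s d : ℕ} (hs : s = m 1 + m (-1))
    (hs0 : 0 < s) (hd : (d : ℝ) ≤ δ * s)
    (h1 : 4 * m 1 ≤ 3 * Fintype.card V) (h2 : 4 * m (-1) ≤ 3 * Fintype.card V) :
    ∑ y : V → SignType with labelCount y = m ∧ #(defect G σ y) ≤ d,
      (#{M ∈ nearMatchings V | #(defect M.spanningCoe σ y) ≤ d} : ℝ) ≤
    #(nearMatchings V) * (3 * Real.exp 1 ^ 2 * (((s : ℝ) + 1) ^ 3 *
      Real.exp (unionRate Δ δ) ^ s) * (Fintype.card V : ℝ) ^ (-(1 / 48) : ℝ)) := by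
  set n := Fintype.card V with hn
  have hn0 : 0 < n := Fintype.card_pos
  have hn' : (0 : ℝ) < n := by exact_mod_cast hn0
  have hs0' : (0 : ℝ) < s := by exact_mod_cast hs0
  have hsr : (m 1 + m (-1) : ℝ) = s := by rw [hs]; push_cast; rfl
  have hsn : s ≤ n := by
    have := sum_signType m
    omega
  set w := typeWeight n m with hwdef
  have hw : 0 < w := typeWeight_pos hm
  set b : ℝ := (#{B : Finset V | #B ≤ d} : ℝ) with hb
  have hb0 : 0 ≤ b := Nat.cast_nonneg _
  set R : ℝ := Real.exp 1 ^ 2 * ((s : ℝ) + 1) ^ 2 with hR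
  have hR0 : 0 ≤ R := by positivity
  set N : ℝ := (#(nearMatchings V) : ℝ) with hN
  have hN0 : 0 ≤ N := Nat.cast_nonneg _
  have hX : ∀ y ∈ ({y | labelCount y = m ∧ #(defect G σ y) ≤ d} : Finset (V → SignType)),
      (#{M ∈ nearMatchings V | #(defect M.spanningCoe σ y) ≤ d} : ℝ) ≤
        N * (b * 3 ^ (2 * d + 1)) * R * w ^ (1 / 2 : ℝ) := by
    intro y hy
    have hym : labelCount y = m := (Finset.mem_filter.mp hy).2.1
    have e1 := card_matching_le hσ y d (by rw [hym]; exact hw)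
    rw [hym] at e1
    have e2 := prod_factorial_le hm
    rw [hsr] at e2
    have hfac : (0 : ℝ) < n.factorial := by exact_mod_cast n.factorial_pos
    have hw2 := Real.rpow_pos_of_pos hw (1 / 2 : ℝ)
    refine le_of_mul_le_mul_right ?_ (mul_pos hfac hw2)
    calc _ = _ := (mul_assoc _ _ _).symm
      _ ≤ N * ((b * 3 ^ (2 * d + 1)) * ∏ s, ((m s).factorial : ℝ)) := e1
      _ ≤ N * ((b * 3 ^ (2 * d + 1)) * (n.factorial * w * R)) :=
          mul_le_mul_of_nonneg_left (mul_le_mul_of_nonneg_left e2 (by positivity)) hN0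
      _ = N * ((b * 3 ^ (2 * d + 1)) * (n.factorial * (w ^ (1 / 2 : ℝ) * w ^ (1 / 2 : ℝ)) * R)) := by
          rw [← Real.rpow_add hw, add_halves, Real.rpow_one]
      _ = _ := by ring
  have hcount := card_label_mul_rpow_le G hσ (q := 3) (e := 0) (by norm_num) hΔ (by
    rw [Nat.le_zero, Finset.card_eq_zero, Finset.filter_eq_empty_iff]
    exact fun v _ => not_lt.mpr (hG v)) m d
  set T : Finset (V → SignType) := {y | labelCount y = m ∧ #(defect G σ y) ≤ d} with hT
  have hwsplit : w ^ (1 / 2 : ℝ) = w ^ (1 / (3 : ℕ) : ℝ) * w ^ (1 / 6 : ℝ) := by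
    rw [← Real.rpow_add hw]; norm_num
  obtain ⟨hw1, hw2⟩ := typeWeight_le hm hn0 h1 h2
  rw [hsr] at hw1 hw2
  have hbb : b ≤ Real.exp (δ * s / n * n - δ * s * Real.log (δ * s / n)) := by
    refine card_small_subsets_le V (by positivity) ?_ hd
    rw [div_le_one hn']
    have : (s : ℝ) ≤ n := by exact_mod_cast hsn
    nlinarith
  have hterm := union_term_le (Δ := Δ) hδ hδ' hs0 hsn hd hb0 hbb hw hw1 hw2
  calc _ ≤ ∑ y ∈ T, N * (b * 3 ^ (2 * d + 1)) * R * w ^ (1 / 2 : ℝ) := Finset.sum_le_sum hX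
    _ = (#T * w ^ (1 / (3 : ℕ) : ℝ)) * (N * (b * 3 ^ (2 * d + 1)) * R * w ^ (1 / 6 : ℝ)) := by
        rw [Finset.sum_const, nsmul_eq_mul, hwsplit]; ring
    _ ≤ (b * 3 ^ ((Δ + 1) * d + 0)) * (N * (b * 3 ^ (2 * d + 1)) * R * w ^ (1 / 6 : ℝ)) := by
        gcongr
    _ = N * (R * (b ^ 2 * 3 ^ ((Δ + 3) * d + 1) * w ^ (1 / 6 : ℝ))) := by
        rw [show (Δ + 3) * d + 1 = ((Δ + 1) * d + 0) + (2 * d + 1) by ring, pow_add]; ring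
    _ ≤ N * (R * (3 * ((s + 1) * Real.exp (unionRate Δ δ) ^ s * (n : ℝ) ^ (-(1 / 48) : ℝ)))) := by
        gcongr
    _ = _ := by rw [hR]; ring

/-- The matching `M` is `δ`-bad for `G` if some labelling has few defects in both graphs. -/
def IsBadMatching (G : SimpleGraph V) (δ : ℝ) (M : (⊤ : SimpleGraph V).Subgraph) : Prop :=
  ∃ σ : SignType, (σ = 1 ∨ σ = -1) ∧ ∃ y : V → SignType, 0 < labelCount y 1 + labelCount y (-1) ∧
    4 * labelCount y 1 ≤ 3 * Fintype.card V ∧ 4 * labelCount y (-1) ≤ 3 * Fintype.card V ∧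
    (#(defect G σ y) : ℝ) ≤ δ * ((labelCount y 1 + labelCount y (-1) : ℕ) : ℝ) ∧
    (#(defect M.spanningCoe σ y) : ℝ) ≤ δ * ((labelCount y 1 + labelCount y (-1) : ℕ) : ℝ)

theorem labelCount_ext {y y' : V → SignType} (h1 : labelCount y 1 = labelCount y' 1)
    (h2 : labelCount y (-1) = labelCount y' (-1)) : labelCount y = labelCount y' := by
  have e := sum_labelCount y
  have e' := sum_labelCount y'
  rw [sum_signType] at e e'
  ext s
  rcases s with _ | _ | _
  · change labelCount y 0 = labelCount y' 0; omega
  · exact h2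
  · exact h1

/-- The number of labelled vertices. -/
noncomputable def labelSize (y : V → SignType) : ℕ := labelCount y 1 + labelCount y (-1)

/-- The nonzero labellings with at most `δ` defects per labelled vertex in which no nonzero label has
density over `3 / 4`. -/
noncomputable def sparseLabels (G : SimpleGraph V) (δ : ℝ) (σ : SignType) :
    Finset (V → SignType) :=
  {y | 0 < labelSize y ∧ 4 * labelCount y 1 ≤ 3 * Fintype.card V ∧
    4 * labelCount y (-1) ≤ 3 * Fintype.card V ∧ #(defect G σ y) ≤ ⌊δ * labelSize y⌋₊}

/-- The near-perfect matchings with at most `δ` defects per labelled vertex. -/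
noncomputable def sparseMatchings (δ : ℝ) (σ : SignType) (y : V → SignType) :
    Finset ((⊤ : SimpleGraph V).Subgraph) :=
  {M ∈ nearMatchings V | #(defect M.spanningCoe σ y) ≤ ⌊δ * labelSize y⌋₊}

theorem sum_sparseMatchings_fiber_le [Nonempty V] (G : SimpleGraph V) {Δ : ℕ}
    (hΔ : ∀ v, #{z | G.Adj v z} ≤ Δ) (hG : ∀ v, 3 ≤ #{u | G.Reachable v u})
    {σ : SignType} (hσ : σ = 1 ∨ σ = -1) {δ : ℝ} (hδ : 0 < δ) (hδ' : δ ≤ 1 / 96) (p : ℕ × ℕ) :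
    ∑ y ∈ sparseLabels G δ σ with (labelCount y 1, labelCount y (-1)) = p,
      (#(sparseMatchings δ σ y) : ℝ) ≤
    #(nearMatchings V) * (3 * Real.exp 1 ^ 2 * (Fintype.card V : ℝ) ^ (-(1 / 48) : ℝ)) *
      ((((p.1 : ℝ) + 1) ^ 3 * Real.exp (unionRate Δ δ) ^ p.1) *
        (((p.2 : ℝ) + 1) ^ 3 * Real.exp (unionRate Δ δ) ^ p.2)) := by
  obtain ⟨a, c⟩ := p
  set F : Finset (V → SignType) :=
    {y ∈ sparseLabels G δ σ | (labelCount y 1, labelCount y (-1)) = (a, c)} with hF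
  rcases F.eq_empty_or_nonempty with h0 | ⟨y₀, hy₀⟩
  · rw [h0, Finset.sum_empty]; positivity
  obtain ⟨hy₀Y, hy₀p⟩ := Finset.mem_filter.mp hy₀
  obtain ⟨-, hpos, h1, h2, -⟩ := Finset.mem_filter.mp hy₀Y
  obtain ⟨ha, hc⟩ := Prod.mk.inj hy₀p
  have hlab : ∀ y ∈ F, labelCount y = labelCount y₀ := by
    intro y hy
    obtain ⟨ha', hc'⟩ := Prod.mk.inj (Finset.mem_filter.mp hy).2
    exact labelCount_ext (ha'.trans ha.symm) (hc'.trans hc.symm)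
  have hsize : ∀ y ∈ F, labelSize y = labelSize y₀ := fun y hy => by
    rw [labelSize, hlab y hy, labelSize]
  have hmain := sum_card_matching_le G hΔ hG hσ hδ hδ' (sum_labelCount y₀)
    (s := labelSize y₀) (d := ⌊δ * labelSize y₀⌋₊) rfl hpos (Nat.floor_le (by positivity)) h1 h2
  refine le_trans ?_ (hmain.trans ?_)
  · refine (Finset.sum_le_sum fun y hy => ?_).trans
      (Finset.sum_le_sum_of_subset_of_nonneg (s := F) ?_ fun _ _ _ => Nat.cast_nonneg _)
    · rw [sparseMatchings, hsize y hy]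
    · intro y hy
      have hyY := (Finset.mem_filter.mp (Finset.mem_filter.mp hy).1).2.2.2.2
      rw [hsize y hy] at hyY
      exact Finset.mem_filter.mpr ⟨Finset.mem_univ _, hlab y hy, hyY⟩
  · have hsz : labelSize y₀ = a + c := by rw [labelSize, ha, hc]
    rw [hsz, pow_add]
    push_cast
    set κ := Real.exp (unionRate Δ δ)
    have hprod : ((a : ℝ) + c + 1) ^ 3 ≤ ((a : ℝ) + 1) ^ 3 * ((c : ℝ) + 1) ^ 3 := by
      rw [← mul_pow]
      gcongr
      nlinarith [mul_nonneg (Nat.cast_nonneg (α := ℝ) a) (Nat.cast_nonneg (α := ℝ) c)]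
    have hκ : 0 < κ := Real.exp_pos _
    calc _ ≤ (#(nearMatchings V) : ℝ) * (3 * Real.exp 1 ^ 2 *
            ((((a : ℝ) + 1) ^ 3 * ((c : ℝ) + 1) ^ 3) * (κ ^ a * κ ^ c)) *
            (Fintype.card V : ℝ) ^ (-(1 / 48) : ℝ)) := by gcongr
      _ = _ := by ring

theorem card_biUnion_sparseMatchings_le [Nonempty V] (G : SimpleGraph V) {Δ : ℕ}
    (hΔ : ∀ v, #{z | G.Adj v z} ≤ Δ) (hG : ∀ v, 3 ≤ #{u | G.Reachable v u})
    {σ : SignType} (hσ : σ = 1 ∨ σ = -1) {δ : ℝ} (hδ : 0 < δ) (hδ' : δ ≤ 1 / 96)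
    (hrate : unionRate Δ δ < 0) :
    (#((sparseLabels G δ σ).biUnion (sparseMatchings δ σ)) : ℝ) ≤
      #(nearMatchings V) * (3 * Real.exp 1 ^ 2 * (Fintype.card V : ℝ) ^ (-(1 / 48) : ℝ)) *
        (∑' a : ℕ, ((a : ℝ) + 1) ^ 3 * Real.exp (unionRate Δ δ) ^ a) ^ 2 := by
  set R := Finset.range (Fintype.card V + 1)
  set κ := Real.exp (unionRate Δ δ)
  have hκ0 : 0 < κ := Real.exp_pos _
  have hκ1 : κ < 1 := Real.exp_lt_one_iff.mpr hrate
  have hmaps : ∀ y ∈ sparseLabels G δ σ, (labelCount y 1, labelCount y (-1)) ∈ R ×ˢ R := by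
    intro y _
    have := sum_labelCount y
    rw [sum_signType] at this
    rw [Finset.mem_product, Finset.mem_range, Finset.mem_range]
    constructor <;> dsimp only <;> omega
  have hp : 0 ≤ ∑ a ∈ R, ((a : ℝ) + 1) ^ 3 * κ ^ a := Finset.sum_nonneg fun a _ => by positivity
  have hsumS : ∑ a ∈ R, ((a : ℝ) + 1) ^ 3 * κ ^ a ≤ ∑' a : ℕ, ((a : ℝ) + 1) ^ 3 * κ ^ a :=
    (summable_cube_mul_geometric hκ0.le hκ1).sum_le_tsum _ fun a _ => by positivity
  calc _ ≤ ∑ y ∈ sparseLabels G δ σ, (#(sparseMatchings δ σ y) : ℝ) := by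
        exact_mod_cast Finset.card_biUnion_le
    _ = ∑ p ∈ R ×ˢ R, ∑ y ∈ sparseLabels G δ σ with (labelCount y 1, labelCount y (-1)) = p,
          (#(sparseMatchings δ σ y) : ℝ) := (Finset.sum_fiberwise_of_maps_to hmaps _).symm
    _ ≤ _ := Finset.sum_le_sum fun p _ => sum_sparseMatchings_fiber_le G hΔ hG hσ hδ hδ' p
    _ = #(nearMatchings V) * (3 * Real.exp 1 ^ 2 * (Fintype.card V : ℝ) ^ (-(1 / 48) : ℝ)) *
          (∑ a ∈ R, ((a : ℝ) + 1) ^ 3 * κ ^ a) ^ 2 := by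
        rw [← Finset.mul_sum, sq (∑ a ∈ R, _), Finset.sum_mul_sum, Finset.sum_product]
    _ ≤ _ := by gcongr

/-- Bad matchings are rare. -/
theorem card_badMatching_le [Nonempty V] (G : SimpleGraph V) {Δ : ℕ}
    (hΔ : ∀ v, #{z | G.Adj v z} ≤ Δ) (hG : ∀ v, 3 ≤ #{u | G.Reachable v u})
    {δ : ℝ} (hδ : 0 < δ) (hδ' : δ ≤ 1 / 96) (hrate : unionRate Δ δ < 0) :
    (#{M ∈ nearMatchings V | IsBadMatching G δ M} : ℝ) ≤ #(nearMatchings V) *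
      (2 * (3 * Real.exp 1 ^ 2 *
        (∑' a : ℕ, ((a : ℝ) + 1) ^ 3 * Real.exp (unionRate Δ δ) ^ a) ^ 2) *
        (Fintype.card V : ℝ) ^ (-(1 / 48) : ℝ)) := by
  have hsub : ({M ∈ nearMatchings V | IsBadMatching G δ M} : Finset _) ⊆
      (sparseLabels G δ 1).biUnion (sparseMatchings δ 1) ∪
        (sparseLabels G δ (-1)).biUnion (sparseMatchings δ (-1)) := by
    intro M hM
    obtain ⟨hMn, σ, hσ, y, h0, h1, h2, h3, h4⟩ := Finset.mem_filter.mp hM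
    have hmem : M ∈ (sparseLabels G δ σ).biUnion (sparseMatchings δ σ) := by
      rw [Finset.mem_biUnion]
      exact ⟨y, Finset.mem_filter.mpr ⟨Finset.mem_univ _, h0, h1, h2, Nat.le_floor h3⟩,
        Finset.mem_filter.mpr ⟨hMn, Nat.le_floor h4⟩⟩
    rcases hσ with rfl | rfl
    · exact Finset.mem_union_left _ hmem
    · exact Finset.mem_union_right _ hmem
  calc (#{M ∈ nearMatchings V | IsBadMatching G δ M} : ℝ)
      ≤ (#((sparseLabels G δ 1).biUnion (sparseMatchings δ 1)) : ℝ) +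
          #((sparseLabels G δ (-1)).biUnion (sparseMatchings δ (-1))) := by
        exact_mod_cast (Finset.card_le_card hsub).trans (Finset.card_union_le _ _)
    _ ≤ _ := add_le_add
        (card_biUnion_sparseMatchings_le G hΔ hG (Or.inl rfl) hδ hδ' hrate)
        (card_biUnion_sparseMatchings_le G hΔ hG (Or.inr rfl) hδ hδ' hrate)
    _ = _ := by ring

end UnionBound

section Final

open scoped Classical

variable {V : Type*} [Fintype V] {G : SimpleGraph V} {M : (⊤ : SimpleGraph V).Subgraph} {δ : ℝ}

theorem card_ne_zero_eq (y : V → SignType) :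
    #{x | y x ≠ 0} = labelCount y 1 + labelCount y (-1) := by
  rw [labelCount, labelCount, ← Finset.card_union_of_disjoint]
  · congr 1
    ext x
    simp only [Finset.mem_filter, Finset.mem_univ, true_and, Finset.mem_union]
    cases y x <;> decide
  · rw [Finset.disjoint_filter]
    intro x _ h1 h2
    rw [h1] at h2
    exact absurd h2 (by decide)

/-- In a near-perfect matching with few defects, opposite labels are almost equally frequent. -/
theorem IsNearPerfectMatching.labelCount_le (hM : IsNearPerfectMatching M) (y : V → SignType)
    {s : SignType} (hs : s ≠ 0) :
    labelCount y s ≤ #(defect M.spanningCoe (-1) y) + 1 + labelCount y (-s) := by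
  have hsub : ({x | y x = s} : Finset V) ⊆ (defect M.spanningCoe (-1) y ∪ ({v | v ∉ M.verts} : Finset V)) ∪
      ({z | y z = -s} : Finset V).biUnion (fun z => {x | M.spanningCoe.Adj z x}) := by
    intro x hx
    have hx : y x = s := (Finset.mem_filter.mp hx).2
    by_cases hxM : x ∈ M.verts
    · obtain ⟨z, hz, -⟩ := hM.1 hxM
      by_cases hyz : y z = -s
      · refine Finset.mem_union_right _ (Finset.mem_biUnion.mpr ⟨z, ?_, ?_⟩)
        · simpa using hyz
        · simpa using hz.symm
      · refine Finset.mem_union_left _ (Finset.mem_union_left _ ?_)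
        rw [defect, Finset.mem_filter]
        exact ⟨Finset.mem_univ _, by rwa [hx], z, hz, by rwa [hx, neg_one_mul]⟩
    · exact Finset.mem_union_left _ (Finset.mem_union_right _ (by simpa using hxM))
  have h1 := Finset.card_biUnion_le_card_mul ({z | y z = -s} : Finset V)
    (fun z => ({x | M.spanningCoe.Adj z x} : Finset V)) 1 (fun z _ => hM.degree_le z)
  have h2 := hM.card_unmatched_le
  have h3 := Finset.card_le_card hsub
  have h4 := Finset.card_union_le (defect M.spanningCoe (-1) y ∪ ({v | v ∉ M.verts} : Finset V))
    (({z | y z = -s} : Finset V).biUnion (fun z => {x | M.spanningCoe.Adj z x}))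
  have h5 := Finset.card_union_le (defect M.spanningCoe (-1) y) {v | v ∉ M.verts}
  simp only [labelCount]
  omega

theorem card_defect_le_energy {A : V → V → ℝ} (hA : ∀ x z, 0 ≤ A x z) {H : SimpleGraph V}
    (hH : ∀ x z, H.Adj x z → 1 ≤ A x z) {σ : SignType} (hσ : σ = 1 ∨ σ = -1) (y : V → SignType) :
    (#(defect H σ y) : ℝ) ≤ ∑ x, ∑ z, A x z * |(y x : ℝ) - σ * y z| := by
  have h0 : ∀ x z, 0 ≤ A x z * |(y x : ℝ) - σ * y z| := fun x z =>
    mul_nonneg (hA x z) (abs_nonneg _)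
  have hval : ∀ a b : SignType, b ≠ σ * a → (1 : ℝ) ≤ |(a : ℝ) - σ * b| := by
    rcases hσ with rfl | rfl <;> intro a b <;> cases a <;> cases b <;> intro h <;>
    first
    | exact absurd rfl h
    | norm_num
  calc (#(defect H σ y) : ℝ) = ∑ x ∈ defect H σ y, (1 : ℝ) := by simp
    _ ≤ ∑ x ∈ defect H σ y, ∑ z, A x z * |(y x : ℝ) - σ * y z| := by
        refine Finset.sum_le_sum fun x hx => ?_
        obtain ⟨-, -, z, hz, hne⟩ := Finset.mem_filter.mp hx
        have h1 := one_le_mul_of_one_le_of_one_le (hH x z hz) (hval _ _ hne)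
        exact h1.trans (Finset.single_le_sum (f := fun z => A x z * |(y x : ℝ) - σ * y z|)
          (fun z _ => h0 x z) (Finset.mem_univ z))
    _ ≤ _ := Finset.sum_le_sum_of_subset_of_nonneg (Finset.subset_univ _)
        fun x _ _ => Finset.sum_nonneg fun z _ => h0 x z

theorem signedExpander_of_not_isBadMatching (hM : IsNearPerfectMatching M)
    (hbad : ¬ IsBadMatching G δ M) (hδ' : δ ≤ 1 / 96) (hn : 3 ≤ Fintype.card V)
    {A : V → V → ℝ} (hA : ∀ x z, 0 ≤ A x z) (hAG : ∀ x z, G.Adj x z → 1 ≤ A x z)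
    (hAM : ∀ x z, M.spanningCoe.Adj x z → 1 ≤ A x z) : SignedExpander A δ := by
  intro σ hσ y hy0 hhalf
  have hcard : (#{x | y x ≠ 0}) = labelCount y 1 + labelCount y (-1) := card_ne_zero_eq y
  have hpos : 0 < labelCount y 1 + labelCount y (-1) := by
    rw [← hcard, Finset.card_pos]
    obtain ⟨x, hx⟩ := Function.ne_iff.mp hy0
    exact ⟨x, by simpa using hx⟩
  have hle : labelCount y 1 + labelCount y (-1) ≤ Fintype.card V := by
    have := sum_labelCount y
    rw [sum_signType] at this
    omega
  suffices h : δ * ((labelCount y 1 + labelCount y (-1) : ℕ) : ℝ) <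
      max (#(defect G σ y) : ℝ) (#(defect M.spanningCoe σ y) : ℝ) by
    rw [hcard]
    exact h.le.trans (max_le (card_defect_le_energy hA hAG hσ y) (card_defect_le_energy hA hAM hσ y))
  by_contra! hmax
  obtain ⟨hdG, hdM⟩ := max_le_iff.mp hmax
  refine hbad ⟨σ, hσ, y, hpos, ?_, ?_, hdG, hdM⟩
  all_goals
    by_contra! hlt
    rcases hσ with rfl | rfl
    · obtain ⟨h1, h2⟩ := hhalf rfl
      change 2 * labelCount y 1 ≤ _ at h1
      change 2 * labelCount y (-1) ≤ _ at h2
      omega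
    · have e1 := hM.labelCount_le y (s := 1) (by decide)
      have e2 := hM.labelCount_le y (s := -1) (by decide)
      rw [neg_neg] at e2
      have e3 : (#(defect M.spanningCoe (-1) y) : ℝ) ≤ Fintype.card V / 96 := by
        have : ((labelCount y 1 + labelCount y (-1) : ℕ) : ℝ) ≤ Fintype.card V := by
          exact_mod_cast hle
        have h0 : (0 : ℝ) ≤ ((labelCount y 1 + labelCount y (-1) : ℕ) : ℝ) := Nat.cast_nonneg _
        nlinarith
      have e4 : 96 * #(defect M.spanningCoe (-1) y) ≤ Fintype.card V := by
        rw [le_div_iff₀ (by norm_num)] at e3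
        have : (96 * #(defect M.spanningCoe (-1) y) : ℝ) ≤ Fintype.card V := by linarith
        exact_mod_cast this
      omega

theorem isBadMatching_of_closed (hδ : 0 ≤ δ) {T : Finset V} (hT : T.Nonempty)
    (hT2 : 2 * #T ≤ Fintype.card V)
    (hGT : ∀ x z, (G ⊔ M.spanningCoe).Adj x z → (x ∈ T ↔ z ∈ T)) : IsBadMatching G δ M := by
  let y : V → SignType := fun x => if x ∈ T then 1 else 0
  have h1 : labelCount y 1 = #T := by
    simp only [labelCount, y]
    congr 1
    ext x
    by_cases h : x ∈ T <;> simp [h]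
  have h2 : labelCount y (-1) = 0 := by
    simp only [labelCount, y, Finset.card_eq_zero, Finset.filter_eq_empty_iff]
    intro x _
    split_ifs <;> decide
  have hdef : ∀ H : SimpleGraph V, H ≤ G ⊔ M.spanningCoe → #(defect H 1 y) = 0 := by
    intro H hH
    rw [Finset.card_eq_zero, defect, Finset.filter_eq_empty_iff]
    rintro x - ⟨-, z, hz, hne⟩
    apply hne
    simp only [y, hGT x z (hH hz), one_mul]
  have hpos := hT.card_pos
  refine ⟨1, Or.inl rfl, y, by omega, by omega, by omega, ?_, ?_⟩
  · rw [hdef G le_sup_left]; push_cast; positivity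
  · rw [hdef _ le_sup_right]; push_cast; positivity

theorem connected_of_not_isBadMatching [Nonempty V] (hδ : 0 ≤ δ)
    (hbad : ¬ IsBadMatching G δ M) : (G ⊔ M.spanningCoe).Connected := by
  rw [SimpleGraph.connected_iff]
  refine ⟨fun u v => ?_, ‹_›⟩
  by_contra huv
  set S : Finset V := {x | (G ⊔ M.spanningCoe).Reachable u x} with hS
  have hclosed : ∀ x z, (G ⊔ M.spanningCoe).Adj x z → (x ∈ S ↔ z ∈ S) := by
    intro x z hxz
    simp only [hS, Finset.mem_filter, Finset.mem_univ, true_and]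
    exact ⟨fun h => h.trans hxz.reachable, fun h => h.trans hxz.symm.reachable⟩
  have hcard := Finset.card_add_card_compl S
  rcases le_total (2 * #S) (Fintype.card V) with h | h
  · exact hbad (isBadMatching_of_closed hδ ⟨u, by simp [hS]⟩ h hclosed)
  · refine hbad (isBadMatching_of_closed hδ (T := Sᶜ) ⟨v, by simpa [hS] using huv⟩ (by omega) ?_)
    intro x z hxz
    rw [Finset.mem_compl, Finset.mem_compl, hclosed x z hxz]

theorem matchingProb_le [Nonempty V] {E : (⊤ : SimpleGraph V).Subgraph → Prop} {K : ℝ} (hK : 0 ≤ K)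
    (hcard : (#{M ∈ nearMatchings V | IsBadMatching G δ M} : ℝ) ≤ #(nearMatchings V) * K)
    (hE : ∀ M, IsNearPerfectMatching M → E M → IsBadMatching G δ M) : matchingProb V E ≤ K := by
  have hden : {M : (⊤ : SimpleGraph V).Subgraph | IsNearPerfectMatching M}.ncard =
      #(nearMatchings V) := Set.ncard_eq_toFinset_card _ _
  have hnum : {M : (⊤ : SimpleGraph V).Subgraph | IsNearPerfectMatching M ∧ E M}.ncard ≤
      #{M ∈ nearMatchings V | IsBadMatching G δ M} := by
    rw [← Set.ncard_coe_finset]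
    refine Set.ncard_le_ncard (fun M hM => ?_) (Set.toFinite _)
    rw [Finset.mem_coe, Finset.mem_filter, mem_nearMatchings]
    exact ⟨hM.1, hE M hM.1 hM.2⟩
  rw [matchingProb, hden]
  refine div_le_of_le_mul₀ (Nat.cast_nonneg _) hK ?_
  rw [mul_comm]
  exact le_trans (by exact_mod_cast hnum) hcard

theorem starAdj_bounds {V : Type*} (c : EdgeConvention) (G : SimpleGraph V)
    (M : (⊤ : SimpleGraph V).Subgraph) (x z : V) :
    0 ≤ starAdj c G M x z ∧ starAdj c G M x z = starAdj c G M z x ∧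
    (G.Adj x z → 1 ≤ starAdj c G M x z) ∧ (M.spanningCoe.Adj x z → 1 ≤ starAdj c G M x z) ∧
    starAdj c G M x z ≤ (if G.Adj x z then 1 else 0) + (if M.spanningCoe.Adj x z then 1 else 0) := by
  have h1 := G.adj_comm x z
  have h2 := M.spanningCoe.adj_comm x z
  cases c
  · simp only [starAdj, SimpleGraph.adjMatrix_apply, SimpleGraph.sup_adj]
    by_cases hG : G.Adj x z <;> by_cases hM : M.spanningCoe.Adj x z <;>
    simp only [hG, hM, ← h1, ← h2] <;> norm_num
  · simp only [starAdj, Matrix.add_apply, SimpleGraph.adjMatrix_apply]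
    by_cases hG : G.Adj x z <;> by_cases hM : M.spanningCoe.Adj x z <;>
    simp only [hG, hM, ← h1, ← h2] <;> norm_num

theorem sum_starAdj_le (c : EdgeConvention) {Δ : ℕ} (hΔ : ∀ v, #{z | G.Adj v z} ≤ Δ)
    (hM : IsNearPerfectMatching M) (x : V) : ∑ z, starAdj c G M x z ≤ Δ + 1 := by
  refine (Finset.sum_le_sum fun z _ => (starAdj_bounds c G M x z).2.2.2.2).trans ?_
  rw [Finset.sum_add_distrib, Finset.sum_boole, Finset.sum_boole]
  exact add_le_add (by exact_mod_cast hΔ x) (by exact_mod_cast hM.degree_le x)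

theorem sum_starAdj_pos (c : EdgeConvention) (hG : ∀ v, 3 ≤ #{u | G.Reachable v u}) (x : V) :
    0 < ∑ z, starAdj c G M x z := by
  obtain ⟨u, hu, hux⟩ := Finset.exists_mem_ne (s := {u | G.Reachable x u})
    (by have := hG x; omega) x
  obtain ⟨p⟩ := (Finset.mem_filter.mp hu).2
  cases p with
  | nil => exact absurd rfl hux
  | cons h _ =>
    exact lt_of_lt_of_le (zero_lt_one.trans_le ((starAdj_bounds c G M x _).2.2.1 h))
      (Finset.single_le_sum (f := fun z => starAdj c G M x z)
        (fun z _ => (starAdj_bounds c G M x z).1) (Finset.mem_univ _))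

end Final

theorem theoremt (Δ : ℕ) :
    ∃ α : ℝ, 0 < α ∧ α < 1 ∧ ∃ C : ℝ, 0 < C ∧
      ∀ (V : Type*) [Fintype V] [DecidableEq V] [Nonempty V]
        (G : SimpleGraph V) [DecidableRel G.Adj],
        (∀ v, G.degree v ≤ Δ) →
        (∀ K : G.ConnectedComponent, 3 ≤ K.supp.ncard) →
        ∀ c : EdgeConvention,
          matchingProb V (fun M => 1 - lambdaTwo (starWalk c G M) ≤ α)
              ≤ C * (Fintype.card V : ℝ) ^ (-α) ∧
          matchingProb V (fun M => 1 + lambdaMin (starWalk c G M) ≤ α)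
              ≤ C * (Fintype.card V : ℝ) ^ (-α) ∧
          matchingProb V (fun M =>
              ¬ ((G ⊔ M.spanningCoe).Connected ∧ α < absSpectralGap (starWalk c G M)))
              ≤ C * (Fintype.card V : ℝ) ^ (-α) := by
  obtain ⟨δ, hδ, hδ', hrate⟩ := exists_unionRate_neg Δ
  set D : ℝ := Δ + 1 with hD
  have hD0 : 0 < D := by positivity
  set β : ℝ := δ ^ 2 / (8 * D ^ 2) with hβ
  have hβ0 : 0 < β := by positivity
  set α : ℝ := min (1 / 48) (β / 2) with hα
  have hα0 : 0 < α := lt_min (by norm_num) (by positivity)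
  have hα1 : α ≤ 1 / 48 := min_le_left _ _
  have hαβ : α < β := (min_le_right _ _).trans_lt (half_lt_self hβ0)
  set S := ∑' a : ℕ, ((a : ℝ) + 1) ^ 3 * Real.exp (unionRate Δ δ) ^ a with hS
  refine ⟨α, hα0, by linarith, 2 * (3 * Real.exp 1 ^ 2 * S ^ 2) + 1, by positivity, ?_⟩
  intro V _ _ _ G _ hdeg hcomp c
  have hΔ : ∀ v, #{z | G.Adj v z} ≤ Δ := by
    intro v
    rw [← G.neighborFinset_eq_filter]
    exact hdeg v
  have hG : ∀ v, 3 ≤ #{u | G.Reachable v u} := by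
    intro v
    have h := hcomp (G.connectedComponentMk v)
    rw [Set.ncard_eq_toFinset_card'] at h
    refine h.trans (le_of_eq ?_)
    congr 1
    ext u
    simp [SimpleGraph.reachable_comm]
  have hn : 3 ≤ Fintype.card V :=
    (hG (Classical.arbitrary V)).trans (Finset.card_le_univ _)
  have hbadcard := card_badMatching_le G (by convert hΔ) (by convert hG) hδ hδ' hrate
  set K : ℝ := 2 * (3 * Real.exp 1 ^ 2 * S ^ 2) * (Fintype.card V : ℝ) ^ (-(1 / 48) : ℝ) with hK
  have hK0 : 0 ≤ K := by positivity
  have hn1 : (1 : ℝ) ≤ Fintype.card V := by exact_mod_cast (by omega : 1 ≤ Fintype.card V)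
  have hKC : K ≤ (2 * (3 * Real.exp 1 ^ 2 * S ^ 2) + 1) * (Fintype.card V : ℝ) ^ (-α) := by
    rw [hK]
    gcongr
    linarith
  have hgood : ∀ M, IsNearPerfectMatching M → ¬ IsBadMatching G δ M →
      α < 1 - lambdaTwo (starWalk c G M) ∧ α < 1 + lambdaMin (starWalk c G M) ∧
      (G ⊔ M.spanningCoe).Connected ∧ α < absSpectralGap (starWalk c G M) := by
    intro M hM hbad
    have hb := starAdj_bounds c G M
    have hE := signedExpander_of_not_isBadMatching hM hbad hδ' hn (A := starAdj c G M)
      (fun x z => (hb x z).1) (fun x z => (hb x z).2.2.1) (fun x z => (hb x z).2.2.2.1)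
    obtain ⟨h1, h2, h3⟩ := walkMatrix_spectral_bounds hE (fun x z => (hb x z).1)
      (fun x z => (hb x z).2.1) (sum_starAdj_pos c (by convert hG))
      (sum_starAdj_le c (by convert hΔ) hM) hD0 hδ.le (by omega)
    change lambdaTwo (starWalk c G M) ≤ _ at h1
    change _ ≤ lambdaMin (starWalk c G M) at h2
    refine ⟨?_, ?_, connected_of_not_isBadMatching hδ.le hbad,
      lt_absSpectralGap h3 ?_ (by linarith)⟩ <;> linarith
  refine ⟨?_, ?_, ?_⟩ <;>
  refine (matchingProb_le hK0 hbadcard fun M hM hEM => ?_).trans hKC <;>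
  by_contra hbad <;>
  obtain ⟨h1, h2, h3⟩ := hgood M hM hbad
  · linarith
  · linarith
  · exact hEM h3
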